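/- Let $\Delta,\Gamma\ge 0$ be integers. For integers $n\ge\Delta$, $m\ge\Gamma$ let $\mathfrak s^{\Delta,\Gamma}_{n,m}$ be the complex Lie superalgebra generated, under the supercommutator $[A,B]_s=AB-(-1)^{\deg A\deg B}BA$, by the following $2\times2$ matrix differential operators in $x,y$ (diagonal matrices are even, antidiagonal matrices are odd): $$S^\epsilon=\operatorname{diag}(J^\epsilon_{n-\Delta},J^\epsilon_n),\quad T^\epsilon=\operatorname{diag}(K^\epsilon_m,K^\epsilon_{m-\Gamma})\quad(\epsilon=+,-,0),$$ $$J=\tfrac12\operatorname{diag}(n+\Delta,n),\qquad K=\tfrac12\operatorname{diag}(m,m+\Gamma),$$ $$Q^-_{\alpha\beta}=x^\alpha\,\bar q_\beta(y,m,\Gamma)\,\sigma^-,\qquad Q^+_{\alpha\beta}=\bar q_\alpha(x,n,\Delta)\,y^\beta\,\sigma^+\qquad(0\le\alpha\le\Delta,\ 0\le\beta\le\Gamma).$$ Here $J^+_n=x^2\partial_x-nx$, $J^-_n=\partial_x$, $J^0_n=x\partial_x-\frac n2$; the operators $K^\epsilon_m$ are given by the same formulas with $y,m$ in place of $x,n$;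 $\sigma^+=(\sigma^-)^t=\begin{pmatrix}0&1\\0&0\end{pmatrix}$; and $\bar q_\alpha(x,n,\Delta)=\prod_{k=1}^{\Delta-\alpha}(x\partial_x-n+\Delta-k)\,\partial_x^\alpha$, an empty product being $1$. Let $\mathfrak s^{\Delta,\Gamma}$ be the abstract Lie superalgebra realized by these generators, that is, the complex Lie superalgebra generated by the same operators with $n$ and $m$ regarded as formal parameters (indeterminates). (i) $\mathfrak s^{\Delta,\Gamma}$ is finite-dimensional if and only if $\Delta+\Gamma\le1$. Likewise, for all integers $n\ge\Delta$, $m\ge\Gamma$, the realization $\mathfrak s^{\Delta,\Gamma}_{n,m}$ is finite-dimensional if and only if $\Delta+\Gamma\le1$. (ii) Omit the central generator $K$ when $(\Delta,\Gamma)=(1,0)$, and the central generator $J$ when $(\Delta,\Gamma)=(0,1)$. Then, as Lie superalgebras, $$\mathfrak s^{1,0}\simeq\mathfrak s^{0,1}\simeq\mathfrak{spl}(2,1)\oplus\mathfrak{sl}_2,$$ where $\mathfrak{spl}(2,1)$ is the Lie superalgebra of complex $3\times3$ matrices of block format $2+1$ with vanishing supertrace; and the same holds for all realizations $\mathfrak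 s^{1,0}_{n,m}$ ($n\ge1$, $m\ge0$) and $\mathfrak s^{0,1}_{n,m}$ ($n\ge0$, $m\ge1$). (iii) For $\Delta=\Gamma=0$, replace $J$ and $K$ by $\operatorname{diag}(1,-1)$ and regard $\mathfrak s^{0,0}$ as a Lie algebra under the ordinary commutator. Then $\mathfrak s^{0,0}\simeq\mathfrak{sl}_2\oplus\mathfrak{sl}_2\oplus\mathfrak{sl}_2$, and the same holds for all realizations $\mathfrak s^{0,0}_{n,m}$ ($n,m\ge0$). -/

import Mathlib

noncomputable section

/-! ## Lie superalgebras over `ℂ` -/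

/-- The sign `(-1)^(i j)` for `i, j ∈ ℤ/2`. -/
def superSign (i j : ZMod 2) : ℂ := if i = 1 ∧ j = 1 then -1 else 1

/-- A complex Lie superalgebra: a `ℤ/2`-graded vector space `L = L₀ ⊕ L₁` (with `Lᵢ = homog i`)
and a bilinear bracket of degree zero, graded skew-symmetric and satisfying the graded Jacobi
identity. -/
class LieSuperalgebra (L : Type*) [AddCommGroup L] [Module ℂ L] where
  sbr : L →ₗ[ℂ] L →ₗ[ℂ] L
  homog : ZMod 2 → Submodule ℂ L
  isCompl : IsCompl (homog 0) (homog 1)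
  sbr_mem : ∀ {i j : ZMod 2} {a b : L}, a ∈ homog i → b ∈ homog j → sbr a b ∈ homog (i + j)
  skew : ∀ {i j : ZMod 2} {a b : L}, a ∈ homog i → b ∈ homog j →
    sbr a b = -(superSign i j • sbr b a)
  jacobi : ∀ {i j k : ZMod 2} {a b c : L}, a ∈ homog i → b ∈ homog j → c ∈ homog k →
    sbr a (sbr b c) = sbr (sbr a b) c + superSign i j • sbr b (sbr a c)

open LieSuperalgebra

/-- Isomorphism of Lie superalgebras: a linear bijection, compatible with brackets, that
preserves parity. -/
def SuperIso (L M : Type*) [AddCommGroup L] [Module ℂ L] [LieSuperalgebra L]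
    [AddCommGroup M] [Module ℂ M] [LieSuperalgebra M] : Prop :=
  ∃ e : L ≃ₗ[ℂ] M, (∀ a b : L, e (sbr a b) = sbr (e a) (e b)) ∧
    ∀ (i : ZMod 2) (a : L), e a ∈ (homog i : Submodule ℂ M) ↔ a ∈ (homog i : Submodule ℂ L)

/-- A graded subalgebra of a Lie superalgebra. -/
structure LieSubsuperalgebra (L : Type*) [AddCommGroup L] [Module ℂ L] [LieSuperalgebra L] where
  carrier : Submodule ℂ L
  sbr_closed : ∀ {a b : L}, a ∈ carrier → b ∈ carrier → sbr a b ∈ carrier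
  graded : ∀ {a b : L}, a ∈ (homog 0 : Submodule ℂ L) → b ∈ (homog 1 : Submodule ℂ L) →
    a + b ∈ carrier → a ∈ carrier ∧ b ∈ carrier

/-- A graded subalgebra is a Lie superalgebra. -/
instance LieSubsuperalgebra.instLieSuperalgebra {L : Type*} [AddCommGroup L] [Module ℂ L]
    [LieSuperalgebra L] (s : LieSubsuperalgebra L) : LieSuperalgebra s.carrier where
  sbr := LinearMap.mk₂ ℂ (fun a b => ⟨sbr (a : L) (b : L), s.sbr_closed a.2 b.2⟩)
    (by intros; ext; simp) (by intros; ext; simp) (by intros; ext; simp) (by intros; ext; simp)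
  homog i := (homog i).comap s.carrier.subtype
  isCompl := by
    have h : IsCompl (homog 0 : Submodule ℂ L) (homog 1) := LieSuperalgebra.isCompl
    constructor
    · rw [Submodule.disjoint_def]
      intro x h0 h1
      ext
      exact (Submodule.disjoint_def.1 h.disjoint) _ h0 h1
    · rw [codisjoint_iff, eq_top_iff]
      rintro ⟨x, hx⟩ -
      have hx' : x ∈ (homog 0 : Submodule ℂ L) ⊔ homog 1 := by
        rw [codisjoint_iff.1 h.codisjoint]; trivial
      obtain ⟨a, ha, b, hb, rfl⟩ := Submodule.mem_sup.1 hx'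
      obtain ⟨h0, h1⟩ := s.graded ha hb hx
      exact Submodule.mem_sup.2 ⟨⟨a, h0⟩, ha, ⟨b, h1⟩, hb, rfl⟩
  sbr_mem ha hb := LieSuperalgebra.sbr_mem (L := L) ha hb
  skew ha hb := Subtype.ext (LieSuperalgebra.skew (L := L) ha hb)
  jacobi ha hb hc := Subtype.ext (LieSuperalgebra.jacobi (L := L) ha hb hc)

/-- The graded subalgebra generated by a set: the smallest one that contains it. -/
def superSpan {L : Type*} [AddCommGroup L] [Module ℂ L] [LieSuperalgebra L] (S : Set L) :
    LieSubsuperalgebra L where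
  carrier := sInf {p | ∃ s : LieSubsuperalgebra L, s.carrier = p ∧ S ⊆ s.carrier}
  sbr_closed := by
    intro a b ha hb
    rw [Submodule.mem_sInf] at *
    rintro _ ⟨s, rfl, hs⟩
    exact s.sbr_closed (ha _ ⟨s, rfl, hs⟩) (hb _ ⟨s, rfl, hs⟩)
  graded := by
    intro a b ha hb hab
    rw [Submodule.mem_sInf] at hab
    constructor
    · rw [Submodule.mem_sInf]
      rintro _ ⟨s, rfl, hs⟩
      exact (s.graded ha hb (hab _ ⟨s, rfl, hs⟩)).1
    · rw [Submodule.mem_sInf]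
      rintro _ ⟨s, rfl, hs⟩
      exact (s.graded ha hb (hab _ ⟨s, rfl, hs⟩)).2

/-- The direct sum of two Lie superalgebras. -/
instance Prod.instLieSuperalgebra {L M : Type*} [AddCommGroup L] [Module ℂ L] [LieSuperalgebra L]
    [AddCommGroup M] [Module ℂ M] [LieSuperalgebra M] : LieSuperalgebra (L × M) where
  sbr := LinearMap.mk₂ ℂ (fun a b => (sbr a.1 b.1, sbr a.2 b.2))
    (by intros; ext <;> simp) (by intros; ext <;> simp) (by intros; ext <;> simp)
    (by intros; ext <;> simp)
  homog i := (homog i).prod (homog i)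
  isCompl := by
    have h : IsCompl (homog 0 : Submodule ℂ L) (homog 1) := LieSuperalgebra.isCompl
    have h' : IsCompl (homog 0 : Submodule ℂ M) (homog 1) := LieSuperalgebra.isCompl
    constructor
    · rw [disjoint_iff, Submodule.prod_inf_prod, h.inf_eq_bot, h'.inf_eq_bot, Submodule.prod_bot]
    · rw [codisjoint_iff, Submodule.prod_sup_prod, h.sup_eq_top, h'.sup_eq_top, Submodule.prod_top]
  sbr_mem ha hb := ⟨LieSuperalgebra.sbr_mem ha.1 hb.1, LieSuperalgebra.sbr_mem ha.2 hb.2⟩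
  skew ha hb := Prod.ext (LieSuperalgebra.skew ha.1 hb.1) (LieSuperalgebra.skew ha.2 hb.2)
  jacobi ha hb hc := Prod.ext (LieSuperalgebra.jacobi ha.1 hb.1 hc.1)
    (LieSuperalgebra.jacobi ha.2 hb.2 hc.2)

/-- A Lie algebra, seen as a purely even Lie superalgebra. -/
@[reducible] def LieSuperalgebra.ofLieAlgebra (L : Type*) [LieRing L] [LieAlgebra ℂ L] :
    LieSuperalgebra L where
  sbr := LinearMap.mk₂ ℂ (fun a b => ⁅a, b⁆)
    (by intros; simp) (by intros; simp) (by intros; simp) (by intros; simp)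
  homog i := if i = 0 then ⊤ else ⊥
  isCompl := by simpa using isCompl_top_bot
  sbr_mem := by
    intro i j a b ha hb
    by_cases hi : i = 0 <;> by_cases hj : j = 0 <;> simp_all
  skew := by
    intro i j a b ha hb
    by_cases hi : i = 0 <;> by_cases hj : j = 0 <;> simp_all [superSign]
  jacobi := by
    intro i j k a b c ha hb hc
    by_cases hi : i = 0 <;> by_cases hj : j = 0 <;> simp_all [superSign]

/-! ## Matrices with a parity -/

/-- Square matrices over an associative algebra `E` whose rows and columns carry a parity `p`;
the entry `(i, j)` has degree `p i + p j`. -/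
def SuperMatrix {ι : Type} (_p : ι → ZMod 2) (E : Type*) : Type _ := Matrix ι ι E

instance SuperMatrix.instAddCommGroup {ι : Type} (p : ι → ZMod 2) (E : Type*) [Ring E] :
    AddCommGroup (SuperMatrix p E) := inferInstanceAs (AddCommGroup (Matrix ι ι E))

instance SuperMatrix.instModule {ι : Type} (p : ι → ZMod 2) (E : Type*) [Ring E] [Algebra ℂ E] :
    Module ℂ (SuperMatrix p E) := inferInstanceAs (Module ℂ (Matrix ι ι E))

/-- The homogeneous component of degree `k` of a matrix. -/
def superComponent {ι : Type} {E : Type*} [Ring E] (p : ι → ZMod 2) (k : ZMod 2)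
    (a : Matrix ι ι E) : Matrix ι ι E :=
  Matrix.of fun i j => if p i + p j = k then a i j else 0

/-- The matrices that are homogeneous of degree `k`. -/
def superHomogeneous {ι : Type} (p : ι → ZMod 2) (E : Type*) [Ring E] [Algebra ℂ E]
    (k : ZMod 2) : Submodule ℂ (Matrix ι ι E) where
  carrier := {a | ∀ i j, p i + p j ≠ k → a i j = 0}
  add_mem' ha hb i j h := by simp [ha i j h, hb i j h]
  zero_mem' i j _ := rfl
  smul_mem' c a ha i j h := by simp [ha i j h]

/-- The supercommutator: the bilinear extension of `(a, b) ↦ a b - (-1)^(deg a deg b) b a`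
from homogeneous matrices to all matrices. -/
def superCommutator {ι : Type} [Fintype ι] {E : Type*} [Ring E] [Algebra ℂ E] (p : ι → ZMod 2)
    (a b : Matrix ι ι E) : Matrix ι ι E :=
  ∑ k : ZMod 2, ∑ l : ZMod 2, (superComponent p k a * superComponent p l b -
    superSign k l • (superComponent p l b * superComponent p k a))

lemma superComponent_add {ι : Type} {E : Type*} [Ring E] (p : ι → ZMod 2) (k : ZMod 2)
    (a b : Matrix ι ι E) :
    superComponent p k (a + b) = superComponent p k a + superComponent p k b := by
  ext i j
  by_cases h : p i + p j = k <;> simp [superComponent, h]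

lemma superComponent_smul {ι : Type} {E : Type*} [Ring E] [Algebra ℂ E] (p : ι → ZMod 2)
    (k : ZMod 2) (c : ℂ) (a : Matrix ι ι E) :
    superComponent p k (c • a) = c • superComponent p k a := by
  ext i j
  by_cases h : p i + p j = k <;> simp [superComponent, h]

lemma superComponent_mem {ι : Type} {E : Type*} [Ring E] [Algebra ℂ E] (p : ι → ZMod 2)
    (k : ZMod 2) (a : Matrix ι ι E) : superComponent p k a ∈ superHomogeneous p E k := by
  intro i j h
  simp [superComponent, h]

lemma superComponent_of_mem {ι : Type} {E : Type*} [Ring E] [Algebra ℂ E] {p : ι → ZMod 2}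
    {k : ZMod 2} {a : Matrix ι ι E} (ha : a ∈ superHomogeneous p E k) (l : ZMod 2) :
    superComponent p l a = if k = l then a else 0 := by
  ext i j
  by_cases h : p i + p j = k
  · by_cases hl : k = l <;> simp [superComponent, h, hl]
  · have := ha i j h
    by_cases hl : k = l <;> simp [superComponent, hl, this]

lemma superComponent_sum {ι : Type} {E : Type*} [Ring E] (p : ι → ZMod 2)
    (a : Matrix ι ι E) : superComponent p 0 a + superComponent p 1 a = a := by
  have hz : ∀ z : ZMod 2, z = 0 ∨ z = 1 := by decide
  ext i j
  rcases hz (p i + p j) with h | h <;> simp [superComponent, h]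

lemma superCommutator_of_mem {ι : Type} [Fintype ι] {E : Type*} [Ring E] [Algebra ℂ E]
    {p : ι → ZMod 2} {k l : ZMod 2} {a b : Matrix ι ι E} (ha : a ∈ superHomogeneous p E k)
    (hb : b ∈ superHomogeneous p E l) :
    superCommutator p a b = a * b - superSign k l • (b * a) := by
  unfold superCommutator
  simp only [superComponent_of_mem ha, superComponent_of_mem hb]
  rw [Finset.sum_eq_single k, Finset.sum_eq_single l]
  · simp
  · intro j _ hj
    simp [hj.symm]
  · simp
  · intro j _ hj
    simp [hj.symm]
  · simp

lemma superHomogeneous_mul {ι : Type} [Fintype ι] {E : Type*} [Ring E] [Algebra ℂ E]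
    {p : ι → ZMod 2} {k l : ZMod 2} {a b : Matrix ι ι E} (ha : a ∈ superHomogeneous p E k)
    (hb : b ∈ superHomogeneous p E l) : a * b ∈ superHomogeneous p E (k + l) := by
  intro i j h
  rw [Matrix.mul_apply]
  refine Finset.sum_eq_zero fun r _ => ?_
  by_cases h1 : p i + p r = k
  · by_cases h2 : p r + p j = l
    · exfalso
      apply h
      rw [← h1, ← h2, add_assoc, ← add_assoc (p r), CharTwo.add_self_eq_zero, zero_add]
    · rw [hb _ _ h2, mul_zero]
  · rw [ha _ _ h1, zero_mul]

lemma superCommutator_mem {ι : Type} [Fintype ι] {E : Type*} [Ring E] [Algebra ℂ E]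
    {p : ι → ZMod 2} {k l : ZMod 2} {a b : Matrix ι ι E} (ha : a ∈ superHomogeneous p E k)
    (hb : b ∈ superHomogeneous p E l) :
    superCommutator p a b ∈ superHomogeneous p E (k + l) := by
  rw [superCommutator_of_mem ha hb]
  refine Submodule.sub_mem _ (superHomogeneous_mul ha hb) (Submodule.smul_mem _ _ ?_)
  rw [add_comm]
  exact superHomogeneous_mul hb ha

lemma superHomogeneous_isCompl {ι : Type} (p : ι → ZMod 2) (E : Type*) [Ring E] [Algebra ℂ E] :
    IsCompl (superHomogeneous p E 0) (superHomogeneous p E 1) := by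
  constructor
  · refine Submodule.disjoint_def.2 fun a h0 h1 => ?_
    have h := superComponent_of_mem h0 0
    rw [superComponent_of_mem h1 0] at h
    simpa using h.symm
  · refine codisjoint_iff.2 (eq_top_iff.2 fun a _ => ?_)
    exact Submodule.mem_sup.2 ⟨superComponent p 0 a, superComponent_mem p 0 a,
      superComponent p 1 a, superComponent_mem p 1 a, superComponent_sum p a⟩

lemma superCommutator_skew {ι : Type} [Fintype ι] {E : Type*} [Ring E] [Algebra ℂ E]
    {p : ι → ZMod 2} {i j : ZMod 2} {a b : Matrix ι ι E} (ha : a ∈ superHomogeneous p E i)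
    (hb : b ∈ superHomogeneous p E j) :
    superCommutator p a b = -(superSign i j • superCommutator p b a) := by
  rw [superCommutator_of_mem ha hb, superCommutator_of_mem hb ha]
  by_cases hi : i = 1 <;> by_cases hj : j = 1 <;> simp [superSign, hi, hj, add_comm]

lemma superCommutator_jacobi {ι : Type} [Fintype ι] {E : Type*} [Ring E] [Algebra ℂ E]
    {p : ι → ZMod 2} {i j k : ZMod 2} {a b c : Matrix ι ι E} (ha : a ∈ superHomogeneous p E i)
    (hb : b ∈ superHomogeneous p E j) (hc : c ∈ superHomogeneous p E k) :
    superCommutator p a (superCommutator p b c) = superCommutator p (superCommutator p a b) c +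
      superSign i j • superCommutator p b (superCommutator p a c) := by
  rw [superCommutator_of_mem ha (superCommutator_mem hb hc), superCommutator_of_mem hb hc,
    superCommutator_of_mem (superCommutator_mem ha hb) hc, superCommutator_of_mem ha hb,
    superCommutator_of_mem hb (superCommutator_mem ha hc), superCommutator_of_mem ha hc]
  have hz : ∀ z : ZMod 2, z = 0 ∨ z = 1 := by decide
  have h11 : (1 : ZMod 2) + 1 = 0 := by decide
  rcases hz i with rfl | rfl <;> rcases hz j with rfl | rfl <;> rcases hz k with rfl | rfl <;>
    simp [superSign, h11, mul_add, add_mul, mul_sub, sub_mul, mul_assoc] <;> abel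

/-- The supercommutator as a bilinear map. -/
def superCommutatorBilin {ι : Type} [Fintype ι] {E : Type*} [Ring E] [Algebra ℂ E]
    (p : ι → ZMod 2) : Matrix ι ι E →ₗ[ℂ] Matrix ι ι E →ₗ[ℂ] Matrix ι ι E :=
  LinearMap.mk₂ ℂ (superCommutator p)
    (by
      intro a a' b
      simp only [superCommutator, superComponent_add, add_mul, mul_add, smul_add,
        ← Finset.sum_add_distrib]
      exact Finset.sum_congr rfl fun _ _ => Finset.sum_congr rfl fun _ _ => by abel)
    (by
      intro c a b
      simp only [superCommutator, superComponent_smul, smul_mul_assoc, mul_smul_comm,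
        Finset.smul_sum, smul_sub]
      exact Finset.sum_congr rfl fun _ _ => Finset.sum_congr rfl fun _ _ => by
        rw [smul_comm])
    (by
      intro a b b'
      simp only [superCommutator, superComponent_add, add_mul, mul_add, smul_add,
        ← Finset.sum_add_distrib]
      exact Finset.sum_congr rfl fun _ _ => Finset.sum_congr rfl fun _ _ => by abel)
    (by
      intro c a b
      simp only [superCommutator, superComponent_smul, smul_mul_assoc, mul_smul_comm,
        Finset.smul_sum, smul_sub]
      exact Finset.sum_congr rfl fun _ _ => Finset.sum_congr rfl fun _ _ => by
        rw [smul_comm])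

/-- The Lie superalgebra of all matrices with parity `p`. -/
instance SuperMatrix.instLieSuperalgebra {ι : Type} [Fintype ι] (p : ι → ZMod 2) (E : Type*)
    [Ring E] [Algebra ℂ E] : LieSuperalgebra (SuperMatrix p E) where
  sbr := superCommutatorBilin (E := E) p
  homog k := superHomogeneous p E k
  isCompl := superHomogeneous_isCompl p E
  sbr_mem ha hb := superCommutator_mem ha hb
  skew ha hb := superCommutator_skew ha hb
  jacobi ha hb hc := superCommutator_jacobi ha hb hc

/-! ## The classical Lie superalgebras that occur -/

/-- `sl₂`, seen as a Lie superalgebra. -/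
abbrev SL2 : Type := LieAlgebra.SpecialLinear.sl (Fin 2) ℂ

instance SL2.instLieSuperalgebra : LieSuperalgebra SL2 := LieSuperalgebra.ofLieAlgebra SL2

/-- The parity of the rows and columns of a matrix of block format `2 + 1`. -/
def parity21 : Fin 3 → ZMod 2 := ![0, 0, 1]

/-- `spl(2,1)`: the graded subalgebra of `gl(2,1)` of all matrices of supertrace zero. -/
def spl21 : LieSubsuperalgebra (SuperMatrix parity21 ℂ) where
  carrier :=
    { carrier := {a : Matrix (Fin 3) (Fin 3) ℂ | a 0 0 + a 1 1 - a 2 2 = 0}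
      add_mem' := by
        intro a b ha hb
        change (a 0 0 + b 0 0) + (a 1 1 + b 1 1) - (a 2 2 + b 2 2) = 0
        have ha' : a 0 0 + a 1 1 - a 2 2 = 0 := ha
        have hb' : b 0 0 + b 1 1 - b 2 2 = 0 := hb
        linear_combination ha' + hb'
      zero_mem' := by
        change (0 : ℂ) + 0 - 0 = 0
        simp
      smul_mem' := by
        intro c a ha
        change c * a 0 0 + c * a 1 1 - c * a 2 2 = 0
        have ha' : a 0 0 + a 1 1 - a 2 2 = 0 := ha
        linear_combination c * ha' }
  sbr_closed := by
    intro a b _ _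
    have hs : (Finset.univ : Finset (ZMod 2)) = {0, 1} := by decide
    change superCommutator parity21 (a : Matrix (Fin 3) (Fin 3) ℂ) b 0 0 +
      superCommutator parity21 (a : Matrix (Fin 3) (Fin 3) ℂ) b 1 1 -
      superCommutator parity21 (a : Matrix (Fin 3) (Fin 3) ℂ) b 2 2 = 0
    simp [superCommutator, superComponent, superSign, hs, parity21, Matrix.mul_apply,
      Fin.sum_univ_three]
    ring
  graded := by
    intro a b ha hb hab
    have h : (a 0 0 + b 0 0) + (a 1 1 + b 1 1) - (a 2 2 + b 2 2) = 0 := hab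
    have hd : ∀ i, b i i = 0 := fun i => hb i i (by rw [CharTwo.add_self_eq_zero]; decide)
    constructor
    · change a 0 0 + a 1 1 - a 2 2 = 0
      simpa [hd] using h
    · change b 0 0 + b 1 1 - b 2 2 = 0
      simp [hd]

/-! ## The matrix differential operators -/

/-- The operators on `A[x, y]`. For `A = ℂ`, differential operators in two variables with polynomial
coefficients are identified with their (faithful) action on `ℂ[x, y]`. A larger algebra `A` serves
to carry the parameters `n`, `m` as indeterminates. -/
abbrev PolyOp (A : Type) [CommRing A] : Type := Module.End A (MvPolynomial (Fin 2) A)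

/-- Multiplication by the variable `x` (`i = 0`) or `y` (`i = 1`). -/
def opX (A : Type) [CommRing A] (i : Fin 2) : PolyOp A :=
  LinearMap.mulLeft A (MvPolynomial.X i)

/-- The partial derivative in `x` (`i = 0`) or `y` (`i = 1`). -/
def opD (A : Type) [CommRing A] (i : Fin 2) : PolyOp A :=
  (MvPolynomial.pderiv i : Derivation A (MvPolynomial (Fin 2) A) (MvPolynomial (Fin 2) A))

/-- Multiplication by a constant. -/
def opC {A : Type} [CommRing A] (c : A) : PolyOp A := algebraMap A (PolyOp A) c

/-- One half of a constant. -/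
def half {A : Type} [CommRing A] [Algebra ℂ A] (c : A) : A := (1 / 2 : ℂ) • c

/-- `x² ∂ₓ - ν x`. -/
def opPlus {A : Type} [CommRing A] (i : Fin 2) (ν : A) : PolyOp A :=
  opX A i ^ 2 * opD A i - opC ν * opX A i

/-- `x ∂ₓ - ν / 2`. -/
def opZero {A : Type} [CommRing A] [Algebra ℂ A] (i : Fin 2) (ν : A) : PolyOp A :=
  opX A i * opD A i - opC (half ν)

/-- `∏_{k = 1}^{Δ - α} (x ∂ₓ - ν + Δ - k) ∂ₓ^α`. -/
def qbar {A : Type} [CommRing A] (i : Fin 2) (ν : A) (Δ α : ℕ) : PolyOp A :=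
  ((List.range (Δ - α)).map fun k =>
    opX A i * opD A i - opC ν + opC (Δ : A) - opC ((k + 1 : ℕ) : A)).prod * opD A i ^ α

/-- The parity of the rows and columns of a `2 × 2` matrix: diagonal matrices are even,
antidiagonal matrices are odd. -/
def parity11 : Fin 2 → ZMod 2 := ![0, 1]

/-- The Lie superalgebra of `2 × 2` matrix operators. -/
abbrev MatOp (A : Type) [CommRing A] : Type := SuperMatrix parity11 (PolyOp A)

/-- `diag(a, b)`. -/
def opDiag {A : Type} [CommRing A] (a b : PolyOp A) : Matrix (Fin 2) (Fin 2) (PolyOp A) :=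
  !![a, 0; 0, b]

/-- `a σ⁺`. -/
def opUp {A : Type} [CommRing A] (a : PolyOp A) : Matrix (Fin 2) (Fin 2) (PolyOp A) :=
  !![0, a; 0, 0]

/-- `a σ⁻`. -/
def opDown {A : Type} [CommRing A] (a : PolyOp A) : Matrix (Fin 2) (Fin 2) (PolyOp A) :=
  !![0, 0; a, 0]

/-- The six operators `S⁺, S⁻, S⁰, T⁺, T⁻, T⁰`, for parameters `n = ν`, `m = μ`. -/
def gensST {A : Type} [CommRing A] [Algebra ℂ A] (Δ Γ : ℕ) (ν μ : A) :
    Set (Matrix (Fin 2) (Fin 2) (PolyOp A)) :=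
  {opDiag (opPlus 0 (ν - (Δ : A))) (opPlus 0 ν), opDiag (opD A 0) (opD A 0),
    opDiag (opZero 0 (ν - (Δ : A))) (opZero 0 ν),
    opDiag (opPlus 1 μ) (opPlus 1 (μ - (Γ : A))), opDiag (opD A 1) (opD A 1),
    opDiag (opZero 1 μ) (opZero 1 (μ - (Γ : A)))}

/-- `J = ½ diag(n + Δ, n)`. -/
def genJ {A : Type} [CommRing A] [Algebra ℂ A] (Δ : ℕ) (ν : A) :
    Matrix (Fin 2) (Fin 2) (PolyOp A) :=
  opDiag (opC (half (ν + (Δ : A)))) (opC (half ν))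

/-- `K = ½ diag(m, m + Γ)`. -/
def genK {A : Type} [CommRing A] [Algebra ℂ A] (Γ : ℕ) (μ : A) :
    Matrix (Fin 2) (Fin 2) (PolyOp A) :=
  opDiag (opC (half μ)) (opC (half (μ + (Γ : A))))

/-- The operators `Q⁻_{αβ} = x^α q̄_β(y, m, Γ) σ⁻` and `Q⁺_{αβ} = q̄_α(x, n, Δ) y^β σ⁺`, for
`0 ≤ α ≤ Δ` and `0 ≤ β ≤ Γ`. -/
def gensQ {A : Type} [CommRing A] (Δ Γ : ℕ) (ν μ : A) :
    Set (Matrix (Fin 2) (Fin 2) (PolyOp A)) :=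
  {Q | ∃ α β : ℕ, α ≤ Δ ∧ β ≤ Γ ∧
    (Q = opDown (opX A 0 ^ α * qbar 1 μ Γ β) ∨ Q = opUp (qbar 0 ν Δ α * opX A 1 ^ β))}

/-- The Lie superalgebra generated by all the operators `S`, `T`, `J`, `K`, `Q`. -/
def superS {A : Type} [CommRing A] [Algebra ℂ A] (Δ Γ : ℕ) (ν μ : A) :
    LieSubsuperalgebra (MatOp A) :=
  superSpan (L := MatOp A) (gensST Δ Γ ν μ ∪ {genJ Δ ν, genK Γ μ} ∪ gensQ Δ Γ ν μ)

/-- The case `Δ = 1`, `Γ = 0`, where `K` is a multiple of the identity, without `K`. -/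
def superS10 {A : Type} [CommRing A] [Algebra ℂ A] (ν μ : A) : LieSubsuperalgebra (MatOp A) :=
  superSpan (L := MatOp A) (gensST 1 0 ν μ ∪ {genJ 1 ν} ∪ gensQ 1 0 ν μ)

/-- The case `Δ = 0`, `Γ = 1`, where `J` is a multiple of the identity, without `J`. -/
def superS01 {A : Type} [CommRing A] [Algebra ℂ A] (ν μ : A) : LieSubsuperalgebra (MatOp A) :=
  superSpan (L := MatOp A) (gensST 0 1 ν μ ∪ {genK 1 μ} ∪ gensQ 0 1 ν μ)

section

attribute [local instance] LieRing.ofAssociativeRing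

/-- The case `Δ = Γ = 0`, regarded as a Lie algebra (under the ordinary commutator), with `J` and
`K` replaced by `σ₃ = diag(1, -1)`. -/
def lieS00 {A : Type} [CommRing A] [Algebra ℂ A] (ν μ : A) :
    LieSubalgebra ℂ (Matrix (Fin 2) (Fin 2) (PolyOp A)) :=
  LieSubalgebra.lieSpan ℂ (Matrix (Fin 2) (Fin 2) (PolyOp A))
    (gensST 0 0 ν μ ∪ {opDiag 1 (-1)} ∪ gensQ 0 0 ν μ)

end

/-- The parameters `n` and `m` as indeterminates. -/
abbrev ParamRing : Type := MvPolynomial (Fin 2) ℂ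

/-- The indeterminate `n`. -/
def formalN : ParamRing := MvPolynomial.X 0

/-- The indeterminate `m`. -/
def formalM : ParamRing := MvPolynomial.X 1

end

/-! Every step works for arbitrary ν, μ in a nontrivial commutative ℂ-algebra `A`: taking `A = ℂ[n,
m]` gives the abstract algebras and `A = ℂ` the realizations.

If Δ + Γ = 1, the generators come from a natural action of gl(2,1). On functions of degree ν in two
even variables u, v and one odd variable θ, the matrix units act as z_r ∂_s. Putting u = 1, v = x
turns f₀ + θ f₁ into a pair of functions of x, of degrees ν and ν - 1, and turns ∂_u into ν - x ∂ₓ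
or ν - 1 - x ∂ₓ respectively (`glTwo`, `isSuperHom_glSuper`). The triple S or T of this variable, J
or K, and the Q are the images of a spanning set of spl(2,1). The triple in the other variable
commutes with them and gives the summand sl₂. The combined map is injective for all ν, μ
(`splEmbedding_injective`), and the generators span its image linearly, so no brackets need be
computed (`superIso_superSpan_of_eq`). The omitted K or J is scalar, hence even and central, and
adds at most one dimension.

If Δ = Γ = 0, the Q are constant matrices and commute with the two diagonal copies of sl₂. This
bounds the superalgebra inside a finite-dimensional one; under the ordinary commutator the constants
supply a third sl₂ (`lieS00_eq_range`).

If Δ + Γ ≥ 2, anticommutators of the Q produce D = ∂ₓ^Δ ∂_y^Γ times the identity and a diagonal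
matrix obtained by inserting one factor x or y into D. Repeated bracketing of D with the latter
gives pure derivatives of unbounded order (`opDiag_pow_mem`), which are linearly independent
(`linearIndependent_opD_pow`). -/

noncomputable section

open LieSuperalgebra

/-! ### Homomorphisms and generated subalgebras of Lie superalgebras -/

section LieSuperalgebra

variable {L M N : Type*} [AddCommGroup L] [Module ℂ L] [LieSuperalgebra L]
  [AddCommGroup M] [Module ℂ M] [LieSuperalgebra M]
  [AddCommGroup N] [Module ℂ N] [LieSuperalgebra N]

lemma exists_homog_add (a : L) :
    ∃ a₀ ∈ (homog 0 : Submodule ℂ L), ∃ a₁ ∈ (homog 1 : Submodule ℂ L), a₀ + a₁ = a := by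
  have h : IsCompl (homog 0 : Submodule ℂ L) (homog 1) := LieSuperalgebra.isCompl
  have ha : a ∈ (homog 0 : Submodule ℂ L) ⊔ homog 1 := by
    rw [codisjoint_iff.1 h.codisjoint]; trivial
  exact Submodule.mem_sup.1 ha

lemma eq_zero_of_homog {a b : L} (ha : a ∈ (homog 0 : Submodule ℂ L))
    (hb : b ∈ (homog 1 : Submodule ℂ L)) (hab : a + b = 0) : a = 0 ∧ b = 0 := by
  have h : IsCompl (homog 0 : Submodule ℂ L) (homog 1) := LieSuperalgebra.isCompl
  have h0 : a = 0 := by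
    refine (Submodule.disjoint_def.1 h.disjoint) a ha ?_
    rw [eq_neg_of_add_eq_zero_left hab]
    exact Submodule.neg_mem _ hb
  exact ⟨h0, by simpa [h0] using hab⟩

/-- An even element skew-commutes with every element. -/
lemma sbr_skew_of_even {a : L} (ha : a ∈ (homog 0 : Submodule ℂ L)) (b : L) :
    sbr b a = -sbr a b := by
  obtain ⟨b₀, h₀, b₁, h₁, rfl⟩ := exists_homog_add b
  rw [map_add, LinearMap.add_apply, map_add, skew h₀ ha, skew h₁ ha]
  simp [superSign, add_comm]

/-- A linear map that respects brackets and parity. -/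
structure IsSuperHom (φ : L →ₗ[ℂ] M) : Prop where
  map_sbr : ∀ a b, φ (sbr a b) = sbr (φ a) (φ b)
  map_homog : ∀ {i : ZMod 2} {a : L}, a ∈ (homog i : Submodule ℂ L) →
    φ a ∈ (homog i : Submodule ℂ M)

/-- Homomorphisms whose images commute, the second image being even, combine to a homomorphism on
the direct sum. -/
lemma IsSuperHom.coprod {φ : L →ₗ[ℂ] N} {ψ : M →ₗ[ℂ] N} (hφ : IsSuperHom φ) (hψ : IsSuperHom ψ)
    (heven : ∀ b, ψ b ∈ (homog 0 : Submodule ℂ N)) (hcomm : ∀ a b, sbr (ψ b) (φ a) = 0) :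
    IsSuperHom (φ.coprod ψ) where
  map_sbr := by
    rintro ⟨a, b⟩ ⟨a', b'⟩
    change φ (sbr a a') + ψ (sbr b b') = sbr (φ a + ψ b) (φ a' + ψ b')
    simp [hφ.map_sbr, hψ.map_sbr, hcomm, sbr_skew_of_even (heven b')]
  map_homog := by
    rintro i ⟨a, b⟩ ⟨ha, hb⟩
    exact Submodule.add_mem _ (hφ.map_homog ha) (hψ.map_homog hb)

/-- The image of a homomorphism is a graded subalgebra. -/
def IsSuperHom.range {φ : L →ₗ[ℂ] M} (hφ : IsSuperHom φ) : LieSubsuperalgebra M where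
  carrier := LinearMap.range φ
  sbr_closed := by
    rintro _ _ ⟨a, rfl⟩ ⟨b, rfl⟩
    exact ⟨sbr a b, hφ.map_sbr a b⟩
  graded := by
    rintro a b ha hb ⟨c, hc⟩
    obtain ⟨c₀, h₀, c₁, h₁, rfl⟩ := exists_homog_add c
    -- The differences φ c₀ - a and φ c₁ - b are even and odd with sum zero, so both vanish.
    have h := eq_zero_of_homog (Submodule.sub_mem _ (hφ.map_homog h₀) ha)
      (Submodule.sub_mem _ (hφ.map_homog h₁) hb) (by
        rw [map_add] at hc
        rw [sub_add_sub_comm, hc, sub_self])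
    exact ⟨⟨c₀, sub_eq_zero.1 h.1⟩, ⟨c₁, sub_eq_zero.1 h.2⟩⟩

lemma subset_superSpan (S : Set L) : S ⊆ (superSpan S).carrier := by
  intro a ha
  refine Submodule.mem_sInf.2 ?_
  rintro _ ⟨s, rfl, hs⟩
  exact hs ha

lemma superSpan_le {S : Set L} {s : LieSubsuperalgebra L} (h : S ⊆ s.carrier) :
    (superSpan S).carrier ≤ s.carrier :=
  sInf_le ⟨s, rfl, h⟩

/-- A graded subalgebra generated by generators of the image of an injective homomorphism is
isomorphic to the source of the homomorphism. -/
lemma superIso_of_injective {φ : L →ₗ[ℂ] M} (hφ : IsSuperHom φ) (hinj : ∀ a, φ a = 0 → a = 0)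
    {S : Set M} (hS : S ⊆ LinearMap.range φ) (hgen : LinearMap.range φ ≤ (superSpan S).carrier) :
    SuperIso (superSpan S).carrier L := by
  have hrange : LinearMap.range φ = (superSpan S).carrier :=
    le_antisymm hgen (superSpan_le (s := hφ.range) hS)
  have hinj' : Function.Injective φ := (injective_iff_map_eq_zero φ).2 hinj
  let e : L ≃ₗ[ℂ] (superSpan S).carrier :=
    (LinearEquiv.ofInjective φ hinj').trans (LinearEquiv.ofEq _ _ hrange)
  have he : ∀ a, ((e a : (superSpan S).carrier) : M) = φ a := fun a => rfl
  refine ⟨e.symm, fun a b => ?_, fun i a => ?_⟩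
  · rw [LinearEquiv.symm_apply_eq]
    apply Subtype.ext
    rw [he, hφ.map_sbr, ← he, ← he, e.apply_symm_apply, e.apply_symm_apply]
    rfl
  · obtain ⟨c, rfl⟩ := e.surjective a
    rw [e.symm_apply_apply]
    change c ∈ homog i ↔ φ c ∈ homog i
    refine ⟨hφ.map_homog, fun h => ?_⟩
    -- The image of the component of the wrong parity lies in both homogeneous parts, so it is zero,
    -- and injectivity removes that component.
    obtain ⟨c₀, h₀, c₁, h₁, rfl⟩ := exists_homog_add c
    have hz : ∀ z : ZMod 2, z = 0 ∨ z = 1 := by decide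
    rw [map_add] at h
    rcases hz i with rfl | rfl
    · have := (Submodule.add_mem_iff_right _ (hφ.map_homog h₀)).1 h
      have := (eq_zero_of_homog (Submodule.neg_mem _ this) (hφ.map_homog h₁)
        (neg_add_cancel _)).2
      rw [hinj _ this, add_zero]
      exact h₀
    · have := (Submodule.add_mem_iff_left _ (hφ.map_homog h₁)).1 h
      have := (eq_zero_of_homog (hφ.map_homog h₀) (Submodule.neg_mem _ this)
        (add_neg_cancel _)).1
      rw [hinj _ this, zero_add]
      exact h₁

/-- Adjoining even central elements to a graded subalgebra. -/
def LieSubsuperalgebra.adjoinCentral (s : LieSubsuperalgebra L) (c : L)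
    (heven : c ∈ (homog 0 : Submodule ℂ L)) (hc : ∀ a, sbr c a = 0) : LieSubsuperalgebra L where
  carrier := s.carrier ⊔ ℂ ∙ c
  sbr_closed := by
    intro a b ha hb
    obtain ⟨a, ha', u, hu, rfl⟩ := Submodule.mem_sup.1 ha
    obtain ⟨b, hb', v, hv, rfl⟩ := Submodule.mem_sup.1 hb
    obtain ⟨t, rfl⟩ := Submodule.mem_span_singleton.1 hu
    obtain ⟨t', rfl⟩ := Submodule.mem_span_singleton.1 hv
    simpa [hc, sbr_skew_of_even heven] using Submodule.mem_sup_left (s.sbr_closed ha' hb')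
  graded := by
    intro a b ha hb hab
    obtain ⟨d, hd, u, hu, hdu⟩ := Submodule.mem_sup.1 hab
    obtain ⟨t, rfl⟩ := Submodule.mem_span_singleton.1 hu
    -- Since c is even, its multiple can be absorbed into the even part, leaving a decomposition
    -- inside `s`.
    have h : (a - t • c) + b ∈ s.carrier := by
      have : (a - t • c) + b = d := by rw [eq_sub_of_add_eq hdu]; abel
      rwa [this]
    obtain ⟨h0, h1⟩ := s.graded (Submodule.sub_mem _ ha (Submodule.smul_mem _ t heven)) hb h
    refine ⟨?_, Submodule.mem_sup_left h1⟩
    rw [← sub_add_cancel a (t • c)]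
    exact Submodule.add_mem_sup h0 hu

/-- The sum of a graded subalgebra and the line through an even central element is closed under
brackets. This disposes of the scalar generators J and K. -/
lemma finiteDimensional_superSpan_of_eq_insert {S T : Set L} {c : L} (hT : T = insert c S)
    (hS : FiniteDimensional ℂ (superSpan S).carrier)
    (heven : c ∈ (homog 0 : Submodule ℂ L)) (hc : ∀ a, sbr c a = 0) :
    FiniteDimensional ℂ (superSpan T).carrier := by
  subst hT
  have hle : (superSpan (insert c S)).carrier ≤ (superSpan S).carrier ⊔ ℂ ∙ c := by
    refine superSpan_le (s := (superSpan S).adjoinCentral c heven hc) ?_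
    refine Set.insert_subset (Submodule.mem_sup_right (Submodule.mem_span_singleton_self c)) ?_
    exact fun a ha => Submodule.mem_sup_left (subset_superSpan S ha)
  exact Submodule.finiteDimensional_of_le hle

end LieSuperalgebra

/-- The entries of a supercommutator. -/
lemma superCommutator_apply {ι : Type} [Fintype ι] {E : Type*} [Ring E] [Algebra ℂ E]
    (p : ι → ZMod 2) (a b : Matrix ι ι E) (i j : ι) :
    superCommutator p a b i j = ∑ r, (a i r * b r j -
      superSign (p r + p j) (p i + p r) • (b i r * a r j)) := by
  have hs : (Finset.univ : Finset (ZMod 2)) = {0, 1} := by decide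
  have hz : ∀ z : ZMod 2, z = 0 ∨ z = 1 := by decide
  simp only [superCommutator, Matrix.add_apply, Matrix.sub_apply, Matrix.smul_apply,
    Matrix.mul_apply, superComponent, Matrix.of_apply, hs, Finset.sum_pair zero_ne_one,
    Finset.smul_sum, ← Finset.sum_sub_distrib, ← Finset.sum_add_distrib]
  -- The position of an entry fixes its parity, so only one pair of components contributes to each
  -- product.
  refine Finset.sum_congr rfl fun r _ => ?_
  rcases hz (p i + p r) with h | h <;> rcases hz (p r + p j) with h' | h' <;>
    simp [h, h', superSign, sub_eq_add_neg, add_comm]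

/-! ### The actions of gl₂ and gl(2,1) by differential operators -/

section Operators

open MvPolynomial

variable {A : Type} [CommRing A]

lemma pderiv_pderiv_comm {σ : Type*} (i j : σ) (f : MvPolynomial σ A) :
    pderiv i (pderiv j f) = pderiv j (pderiv i f) := by
  rcases eq_or_ne i j with rfl | h
  · rfl
  · ext m
    simp only [coeff_pderiv, Finsupp.add_apply, Finsupp.single_eq_of_ne h,
      Finsupp.single_eq_of_ne h.symm, add_zero]
    rw [add_right_comm]
    ring

lemma opX_apply (i : Fin 2) (f : MvPolynomial (Fin 2) A) : opX A i f = X i * f := rfl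

lemma opD_apply (i : Fin 2) (f : MvPolynomial (Fin 2) A) : opD A i f = pderiv i f := rfl

lemma opC_apply (c : A) (f : MvPolynomial (Fin 2) A) : opC c f = C c * f := by
  rw [opC, Module.algebraMap_end_apply, C_mul']

lemma opC_commute (c : A) (T : PolyOp A) : Commute T (opC c) :=
  (Algebra.commutes c T).symm

lemma opX_commute_opX (i j : Fin 2) : Commute (opX A i) (opX A j) :=
  LinearMap.ext fun f => by simp only [Module.End.mul_apply, opX_apply]; ring

lemma opD_commute_opD (i j : Fin 2) : Commute (opD A i) (opD A j) :=
  LinearMap.ext fun f => by simp only [Module.End.mul_apply, opD_apply, pderiv_pderiv_comm i j]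

lemma opX_commute_opD {i j : Fin 2} (h : i ≠ j) : Commute (opX A i) (opD A j) :=
  LinearMap.ext fun f => by
    simp [Module.End.mul_apply, opX_apply, opD_apply, pderiv_X_of_ne h]

variable [Algebra ℂ A]

/-- Turns complex scalars into polynomial factors, so that operator identities become identities
accessible to `ring`. -/
lemma complex_smul_eq (c : ℂ) (f : MvPolynomial (Fin 2) A) :
    c • f = C (algebraMap ℂ A c) * f := by
  rw [C_mul', algebraMap_smul]

lemma two_mul_C_half (c : A) : 2 * C (half c) = (C c : MvPolynomial (Fin 2) A) := by
  rw [half, two_mul, ← C_add, ← add_smul]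
  norm_num

/-- The action of `gl₂` by first order operators in one variable. -/
def glTwo (i : Fin 2) (ν : A) : Matrix (Fin 2) (Fin 2) ℂ →ₗ[ℂ] PolyOp A where
  toFun a := a 0 0 • (opC ν - opX A i * opD A i) + a 0 1 • opD A i
    + a 1 0 • (opC ν * opX A i - opX A i ^ 2 * opD A i) + a 1 1 • (opX A i * opD A i)
  map_add' a b := by simp only [Matrix.add_apply]; module
  map_smul' c a := by simp only [Matrix.smul_apply, smul_eq_mul, RingHom.id_apply]; module

lemma glTwo_def (i : Fin 2) (ν : A) (a : Matrix (Fin 2) (Fin 2) ℂ) :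
    glTwo i ν a = a 0 0 • (opC ν - opX A i * opD A i) + a 0 1 • opD A i
    + a 1 0 • (opC ν * opX A i - opX A i ^ 2 * opD A i) + a 1 1 • (opX A i * opD A i) := rfl

lemma glTwo_apply (i : Fin 2) (ν : A) (a : Matrix (Fin 2) (Fin 2) ℂ)
    (f : MvPolynomial (Fin 2) A) :
    glTwo i ν a f = C (algebraMap ℂ A (a 0 0)) * (C ν * f - X i * pderiv i f)
      + C (algebraMap ℂ A (a 0 1)) * pderiv i f
      + C (algebraMap ℂ A (a 1 0)) * (C ν * X i * f - X i ^ 2 * pderiv i f)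
      + C (algebraMap ℂ A (a 1 1)) * (X i * pderiv i f) := by
  simp only [glTwo_def, LinearMap.add_apply, LinearMap.smul_apply, LinearMap.sub_apply,
    Module.End.mul_apply, opX_apply, opD_apply, opC_apply, complex_smul_eq, pow_two]
  ring

lemma commute_glTwo {i : Fin 2} {T : PolyOp A} (hX : Commute T (opX A i))
    (hD : Commute T (opD A i)) (ν : A) (a : Matrix (Fin 2) (Fin 2) ℂ) :
    Commute T (glTwo i ν a) := by
  rw [glTwo_def]
  have hXD := hX.mul_right hD
  exact (((((opC_commute ν T).sub_right hXD).smul_right _).add_right (hD.smul_right _)).add_right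
    ((((opC_commute ν T).mul_right hX).sub_right ((hX.pow_right 2).mul_right hD)).smul_right
    _)).add_right (hXD.smul_right _)

/-- With z₀ = u, z₁ = v the operators are the dehomogenized z_r ∂_s, which satisfy the relations of
matrix units; ν is the degree and may be any constant. -/
lemma glTwo_mul_sub (i : Fin 2) (ν : A) (a b : Matrix (Fin 2) (Fin 2) ℂ) :
    glTwo i ν a * glTwo i ν b - glTwo i ν b * glTwo i ν a = glTwo i ν (a * b - b * a) := by
  refine LinearMap.ext fun f => ?_
  simp only [LinearMap.sub_apply, Module.End.mul_apply, glTwo_apply, Matrix.mul_apply,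
    Fin.sum_univ_two, map_add, map_sub, map_mul, pderiv_mul, pderiv_C, pderiv_X_self, pow_two]
  ring

/-- The entries of the action `glSuper` of `gl(2,1)`. -/
def glSuperEntry (i : Fin 2) (ν : A) (r s : Fin 2) :
    Matrix (Fin 3) (Fin 3) ℂ →ₗ[ℂ] PolyOp A where
  toFun a :=
    -- Entry i is the θ component, of degree ν - 1. The block (i, i) carries θ ∂_θ = 1; the odd
    -- entries are θ ∂_u, θ ∂_v (second line) and u ∂_θ, v ∂_θ (third line) at u = 1, v = x.
    if r = i then
      if s = i then glTwo i (ν - 1) !![a 0 0, a 0 1; a 1 0, a 1 1] + a 2 2 • 1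
      else a 2 0 • (opC ν - opX A i * opD A i) + a 2 1 • opD A i
    else
      if s = i then a 0 2 • 1 + a 1 2 • opX A i
      else glTwo i ν !![a 0 0, a 0 1; a 1 0, a 1 1]
  map_add' a b := by
    split_ifs <;> simp only [glTwo_def, Matrix.add_apply, Matrix.of_apply, Matrix.cons_val',
      Matrix.cons_val_zero, Matrix.cons_val_one, Matrix.cons_val_fin_one] <;> module
  map_smul' c a := by
    split_ifs <;> simp only [glTwo_def, Matrix.smul_apply, Matrix.of_apply, Matrix.cons_val',
      Matrix.cons_val_zero, Matrix.cons_val_one, Matrix.cons_val_fin_one, smul_eq_mul,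
      RingHom.id_apply] <;> module

/-- The action of `gl(2,1)` by matrix differential operators in one variable; the third basis vector
accounts for the entry `i` of the matrices. -/
def glSuper (i : Fin 2) (ν : A) : SuperMatrix parity21 ℂ →ₗ[ℂ] MatOp A where
  toFun a := Matrix.of fun r s => glSuperEntry i ν r s a
  map_add' a b := Matrix.ext fun r s => map_add (glSuperEntry i ν r s) a b
  map_smul' c a := Matrix.ext fun r s => map_smul (glSuperEntry i ν r s) c a

lemma glSuperEntry_apply (i : Fin 2) (ν : A) (r s : Fin 2) (a : Matrix (Fin 3) (Fin 3) ℂ) :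
    glSuperEntry i ν r s a = if r = i then
      if s = i then glTwo i (ν - 1) !![a 0 0, a 0 1; a 1 0, a 1 1] + a 2 2 • 1
      else a 2 0 • (opC ν - opX A i * opD A i) + a 2 1 • opD A i
    else
      if s = i then a 0 2 • 1 + a 1 2 • opX A i
      else glTwo i ν !![a 0 0, a 0 1; a 1 0, a 1 1] := rfl

set_option maxHeartbeats 1000000 in
lemma isSuperHom_glSuper (i : Fin 2) (ν : A) : IsSuperHom (glSuper i ν) where
  map_sbr := by
    intro (a : Matrix (Fin 3) (Fin 3) ℂ) (b : Matrix (Fin 3) (Fin 3) ℂ)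
    refine Matrix.ext fun r s => LinearMap.ext fun f => ?_
    change glSuperEntry i ν r s (superCommutator parity21 a b) f =
      superCommutator parity11 (Matrix.of fun r s => glSuperEntry i ν r s a)
        (Matrix.of fun r s => glSuperEntry i ν r s b) r s f
    have h11 : (1 : ZMod 2) + 1 = 0 := by decide
    simp only [superCommutator_apply, Fin.sum_univ_two, Matrix.of_apply]
    fin_cases i <;> fin_cases r <;> fin_cases s <;>
    simp [glSuperEntry_apply, superCommutator_apply, glTwo_apply, Fin.sum_univ_three, parity21,
      parity11, superSign, h11, complex_smul_eq, opX_apply, opD_apply, opC_apply, pow_two] <;>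
    ring
  map_homog := by
    intro k (a : Matrix (Fin 3) (Fin 3) ℂ) ha r s h
    change glSuperEntry i ν r s a = 0
    -- Diagonal blocks involve only even entries of `a`, off-diagonal blocks only odd ones.
    have h20 := ha 2 0
    have h21 := ha 2 1
    have h02 := ha 0 2
    have h12 := ha 1 2
    have h00 := ha 0 0
    have h01 := ha 0 1
    have h10 := ha 1 0
    have h11 := ha 1 1
    have h22 := ha 2 2
    have h2 : (1 : ZMod 2) + 1 = 0 := by decide
    fin_cases i <;> fin_cases r <;> fin_cases s <;>
    simp_all [parity21, parity11, glSuperEntry_apply, glTwo_def]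

end Operators

/-! ### Embedding spl(2,1) ⊕ sl₂, and tests for vanishing -/

section Embeddings

open MvPolynomial

variable {A : Type} [CommRing A] [Algebra ℂ A]

/-- A scalar diagonal matrix is even, so no sign occurs and the bracket is the entrywise commutator.
-/
lemma sbr_opDiag_self (T : PolyOp A) (M : Matrix (Fin 2) (Fin 2) (PolyOp A)) (r s : Fin 2) :
    superCommutator parity11 (opDiag T T) M r s = T * M r s - M r s * T := by
  simp only [superCommutator_apply, Fin.sum_univ_two]
  have h11 : (1 : ZMod 2) + 1 = 0 := by decide
  fin_cases r <;> fin_cases s <;> simp [parity11, superSign, opDiag, h11] <;> abel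

lemma sbr_opDiag_self_eq_zero {T : PolyOp A} {M : Matrix (Fin 2) (Fin 2) (PolyOp A)}
    (h : ∀ r s, Commute T (M r s)) : sbr (L := MatOp A) (opDiag T T) M = 0 := by
  refine Matrix.ext fun r s => ?_
  change superCommutator parity11 (opDiag T T) M r s = 0
  rw [sbr_opDiag_self, (h r s).eq, sub_self]

lemma opDiag_mem_even (T T' : PolyOp A) :
    (opDiag T T' : MatOp A) ∈ (homog 0 : Submodule ℂ (MatOp A)) := by
  intro r s h
  fin_cases r <;> fin_cases s <;> simp_all [parity11, opDiag]
  exact absurd (by decide) h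

/-- The diagonal action of `sl₂` by first order operators in one variable. -/
def slDiag (i : Fin 2) (ν : A) : SL2 →ₗ[ℂ] MatOp A where
  toFun a := opDiag (glTwo i ν a.1) (glTwo i ν a.1)
  map_add' a b := Matrix.ext fun r s => by
    change opDiag (glTwo i ν (a.1 + b.1)) (glTwo i ν (a.1 + b.1)) r s =
      opDiag (glTwo i ν a.1) (glTwo i ν a.1) r s + opDiag (glTwo i ν b.1) (glTwo i ν b.1) r s
    rw [map_add]
    fin_cases r <;> fin_cases s <;> simp [opDiag]
  map_smul' c a := Matrix.ext fun r s => by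
    change opDiag (glTwo i ν (c • a.1)) (glTwo i ν (c • a.1)) r s =
      c • opDiag (glTwo i ν a.1) (glTwo i ν a.1) r s
    rw [map_smul]
    fin_cases r <;> fin_cases s <;> simp [opDiag]

lemma slDiag_apply (i : Fin 2) (ν : A) (a : SL2) :
    slDiag i ν a = opDiag (glTwo i ν a.1) (glTwo i ν a.1) := rfl

lemma sl2_lie_val (a b : SL2) : (⁅a, b⁆ : SL2).1 = a.1 * b.1 - b.1 * a.1 := rfl

lemma isSuperHom_slDiag (i : Fin 2) (ν : A) : IsSuperHom (slDiag i ν) where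
  map_sbr a b := by
    refine Matrix.ext fun r s => ?_
    change opDiag (glTwo i ν (⁅a, b⁆ : SL2).1) (glTwo i ν (⁅a, b⁆ : SL2).1) r s =
      superCommutator parity11 (opDiag (glTwo i ν a.1) (glTwo i ν a.1))
        (opDiag (glTwo i ν b.1) (glTwo i ν b.1)) r s
    rw [sbr_opDiag_self, sl2_lie_val, ← glTwo_mul_sub]
    fin_cases r <;> fin_cases s <;> simp [opDiag]
  map_homog := by
    intro k a ha
    by_cases hk : k = 0
    · subst hk
      exact opDiag_mem_even _ _
    · have : a = 0 := by simpa [homog, hk] using ha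
      rw [this, map_zero]
      exact Submodule.zero_mem _

lemma glTwo_commute_glTwo {i j : Fin 2} (h : i ≠ j) (ν μ : A) (a b : Matrix (Fin 2) (Fin 2) ℂ) :
    Commute (glTwo i ν a) (glTwo j μ b) :=
  commute_glTwo
    (commute_glTwo (opX_commute_opX j i) (opX_commute_opD h.symm) ν a).symm
    (commute_glTwo (opX_commute_opD h).symm (opD_commute_opD j i) ν a).symm μ b

lemma commute_glSuperEntry {i : Fin 2} {T : PolyOp A} (hX : Commute T (opX A i))
    (hD : Commute T (opD A i)) (ν : A) (r s : Fin 2) (a : Matrix (Fin 3) (Fin 3) ℂ) :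
    Commute T (glSuperEntry i ν r s a) := by
  rw [glSuperEntry_apply]
  split_ifs
  · exact (commute_glTwo hX hD _ _).add_right ((Commute.one_right T).smul_right _)
  · exact (((opC_commute ν T).sub_right (hX.mul_right hD)).smul_right _).add_right
      (hD.smul_right _)
  · exact ((Commute.one_right T).smul_right _).add_right (hX.smul_right _)
  · exact commute_glTwo hX hD _ _

/-- The embedding of `spl(2,1) ⊕ sl₂`. -/
def splEmbedding (i j : Fin 2) (ν μ : A) : spl21.carrier × SL2 →ₗ[ℂ] MatOp A :=
  (glSuper i ν ∘ₗ spl21.carrier.subtype).coprod (slDiag j μ)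

lemma isSuperHom_splEmbedding {i j : Fin 2} (h : i ≠ j) (ν μ : A) :
    IsSuperHom (splEmbedding i j ν μ) := by
  have hi := isSuperHom_glSuper i ν
  refine IsSuperHom.coprod ⟨fun a b => hi.map_sbr a b, fun ha => hi.map_homog ha⟩
    (isSuperHom_slDiag j μ)
    (fun b => opDiag_mem_even _ _) fun a b => sbr_opDiag_self_eq_zero fun r s => ?_
  exact commute_glSuperEntry
    (commute_glTwo (opX_commute_opX i j) (opX_commute_opD h) μ b.1).symm
    (commute_glTwo (opX_commute_opD h.symm).symm (opD_commute_opD i j) μ b.1).symm _ _ _ _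

variable [Nontrivial A]

lemma quadratic_eq_zero {i : Fin 2} {α β γ : ℂ}
    (h : (C (algebraMap ℂ A α) + C (algebraMap ℂ A β) * X i + C (algebraMap ℂ A γ) * X i ^ 2 :
      MvPolynomial (Fin 2) A) = 0) : α = 0 ∧ β = 0 ∧ γ = 0 := by
  have hinj : Function.Injective (algebraMap ℂ A) := (algebraMap ℂ A).injective
  -- Both variables are specialised to t. Since ℂ embeds in `A`, the three values t = 0, 1, -1
  -- determine the coefficients.
  have key : ∀ t : ℂ, α + β * t + γ * t ^ 2 = 0 := fun t => by
    apply hinj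
    simpa using congrArg (aeval fun _ => algebraMap ℂ A t) h
  have h0 := key 0
  have h1 := key 1
  have h2 := key (-1)
  refine ⟨by linear_combination h0, by linear_combination (h1 - h2) / 2,
    by linear_combination (h1 + h2) / 2 - h0⟩

/-- The commutator of the operator with x_i, applied to 1, is a₀₁ + (a₁₁ - a₀₀) x_i - a₁₀ x_i².
Scalars and operators in the other variable commute with x_i, so ν, μ, b and c all drop out. -/
lemma glTwo_eq_zero_aux {i j : Fin 2} (h : i ≠ j) {ν μ : A} {a b : Matrix (Fin 2) (Fin 2) ℂ} {c : ℂ}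
    (hz : glTwo i ν a + glTwo j μ b + c • 1 = 0) : a 0 1 = 0 ∧ a 1 0 = 0 ∧ a 1 1 = a 0 0 := by
  have h1 := LinearMap.congr_fun hz 1
  have hX := LinearMap.congr_fun hz (X i)
  simp only [LinearMap.add_apply, glTwo_apply, LinearMap.smul_apply, Module.End.one_apply,
    complex_smul_eq, pderiv_one, pderiv_X_self, pderiv_X_of_ne h, LinearMap.zero_apply] at h1 hX
  have := quadratic_eq_zero (A := A) (i := i) (α := a 0 1) (β := a 1 1 - a 0 0) (γ := - a 1 0) (by
    simp only [map_sub, map_neg]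
    linear_combination hX - X i * h1)
  exact ⟨this.1, neg_eq_zero.1 this.2.2, sub_eq_zero.1 this.2.1⟩

lemma sl2_trace (a : SL2) : a.1 0 0 + a.1 1 1 = 0 := by
  have h : Matrix.trace a.1 = 0 := LinearMap.mem_ker.1 a.2
  rwa [Matrix.trace_fin_two] at h

lemma sl2_eq_zero {a : SL2} (h : a.1 0 1 = 0 ∧ a.1 1 0 = 0 ∧ a.1 1 1 = a.1 0 0) : a = 0 := by
  have ht := sl2_trace a
  obtain ⟨h01, h10, h11⟩ := h
  have h00 : a.1 0 0 = 0 := by linear_combination ht / 2 - h11 / 2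
  apply Subtype.ext
  refine Matrix.ext fun r s => ?_
  fin_cases r <;> fin_cases s
  exacts [h00, h01, h10, h11.trans h00]

end Embeddings

/-! ### Injectivity of the embedding of spl(2,1) ⊕ sl₂ -/

section Spl

open MvPolynomial

variable {A : Type} [CommRing A] [Algebra ℂ A]

lemma splEmbedding_apply (i j : Fin 2) (ν μ : A) (a : Matrix (Fin 3) (Fin 3) ℂ)
    (ha : a ∈ spl21.carrier) (b : SL2) (r s : Fin 2) :
    splEmbedding i j ν μ (⟨a, ha⟩, b) r s =
      glSuperEntry i ν r s a + opDiag (glTwo j μ b.1) (glTwo j μ b.1) r s := rfl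

lemma splEmbedding_injective [Nontrivial A] {i j : Fin 2} (h : i ≠ j) (ν μ : A)
    (a : spl21.carrier × SL2) (ha : splEmbedding i j ν μ a = 0) : a = 0 := by
  obtain ⟨⟨a, has⟩, b⟩ := a
  change Matrix (Fin 3) (Fin 3) ℂ at a
  have hstr : a 0 0 + a 1 1 - a 2 2 = 0 := has
  have hij : ∀ r s, glSuperEntry i ν r s a + opDiag (glTwo j μ b.1) (glTwo j μ b.1) r s = 0 :=
    fun r s => (splEmbedding_apply i j ν μ a has b r s).symm.trans (congrFun₂ ha r s)
  have hji := h.symm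
  have hd : ∀ r, opDiag (glTwo j μ b.1) (glTwo j μ b.1) r r = glTwo j μ b.1 := fun r => by
    fin_cases r <;> rfl
  have ho : ∀ r s, r ≠ s → opDiag (glTwo j μ b.1) (glTwo j μ b.1) r s = 0 := fun r s => by
    fin_cases r <;> fin_cases s <;> simp [opDiag]
  have hii := hij i i
  have hij' := hij i j
  have hji' := hij j i
  have hjj := hij j j
  simp only [hd, ho _ _ h, ho _ _ hji, glSuperEntry_apply, if_pos, if_neg hji, add_zero]
    at hii hij' hji' hjj
  have hc : ∀ T : PolyOp A, T = 0 → T + (0 : ℂ) • 1 = 0 := fun T hT => by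
    rw [hT, zero_smul, add_zero]
  have h1 := glTwo_eq_zero_aux h (hc _ hjj)
  have h2 := glTwo_eq_zero_aux hji (hc _ ((add_comm _ _).trans hjj))
  simp only [Matrix.of_apply, Matrix.cons_val', Matrix.cons_val_zero, Matrix.cons_val_one,
    Matrix.cons_val_fin_one] at h1
  obtain ⟨h01, h10, h11⟩ := h1
  have hb : b = 0 := sl2_eq_zero h2
  have e1 := LinearMap.congr_fun hii 1
  have e2 := LinearMap.congr_fun hjj 1
  have e3 := LinearMap.congr_fun hij' 1
  have e4 := LinearMap.congr_fun hij' (X i)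
  have e5 := LinearMap.congr_fun hji' 1
  have hb0 : b.1 = 0 := by rw [hb]; rfl
  simp only [hb0, map_zero, add_zero, LinearMap.add_apply, glTwo_apply, LinearMap.smul_apply,
    Module.End.one_apply, complex_smul_eq, pderiv_one, pderiv_X_self, LinearMap.zero_apply,
    Matrix.of_apply, Matrix.cons_val', Matrix.cons_val_zero, Matrix.cons_val_one,
    Matrix.cons_val_fin_one, h01, h10, h11, map_sub, map_one, opX_apply, opD_apply, opC_apply,
    LinearMap.sub_apply, Module.End.mul_apply, mul_zero, zero_mul, mul_one, sub_zero]
    at e1 e2 e3 e4 e5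
  -- Applied to 1, the diagonal entries give a₀₀ (ν - 1) + a₂₂ = 0 and a₀₀ ν = 0, hence a₂₂ = a₀₀,
  -- while zero supertrace gives a₂₂ = 2 a₀₀. Thus a₀₀ = 0 even if ν = 0.
  have h22 : a 2 2 = 2 * a 0 0 := by linear_combination h11 - hstr
  have g1 := quadratic_eq_zero (A := A) (i := i) (α := a 0 0) (β := 0) (γ := 0) (by
    simp only [map_zero, h22, map_mul, map_ofNat] at e1 ⊢
    linear_combination e1 - e2)
  have g2 := quadratic_eq_zero (A := A) (i := i) (α := a 2 1) (β := -a 2 0) (γ := 0) (by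
    simp only [map_zero, map_neg]
    linear_combination e4 - X i * e3)
  have g3 := quadratic_eq_zero (A := A) (i := i) (α := a 0 2) (β := a 1 2) (γ := 0) (by
    simp only [map_zero]
    linear_combination e5)
  refine Prod.ext (Subtype.ext (Matrix.ext fun r s => ?_)) hb
  change a r s = 0
  fin_cases r <;> fin_cases s
  exacts [g1.1, h01, g3.1, h10, h11.trans g1.1, g3.2.1, neg_eq_zero.1 g2.2.1, g2.1,
    h22.trans (by rw [g1.1, mul_zero])]

end Spl

/-! ### Matching generators with elements of spl(2,1) and sl₂ -/

section Generators

open MvPolynomial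

/-- The element of `sl₂` that acts as `x² ∂ₓ - ν x`. -/
def slPlus : SL2 := ⟨!![0, 0; -1, 0], LinearMap.mem_ker.2 (by simp [Matrix.trace_fin_two])⟩

/-- The element of `sl₂` that acts as `∂ₓ`. -/
def slMinus : SL2 := ⟨!![0, 1; 0, 0], LinearMap.mem_ker.2 (by simp [Matrix.trace_fin_two])⟩

/-- The element of `sl₂` that acts as `x ∂ₓ - ν / 2`. -/
def slZero : SL2 :=
  ⟨!![-(1 / 2), 0; 0, 1 / 2], LinearMap.mem_ker.2 (by simp [Matrix.trace_fin_two])⟩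

lemma span_sl2 : Submodule.span ℂ {slPlus, slMinus, slZero} = ⊤ := by
  refine eq_top_iff.2 fun a _ => ?_
  have ha : a = (-a.1 1 0) • slPlus + a.1 0 1 • slMinus + (2 * a.1 1 1) • slZero := by
    have ht := sl2_trace a
    apply Subtype.ext
    refine Matrix.ext fun r s => ?_
    change a.1 r s = (-a.1 1 0) • slPlus.1 r s + a.1 0 1 • slMinus.1 r s +
      (2 * a.1 1 1) • slZero.1 r s
    fin_cases r <;> fin_cases s <;> simp [slPlus, slMinus, slZero]
    · linear_combination ht
    · ring
  rw [ha]
  refine Submodule.add_mem _ (Submodule.add_mem _ ?_ ?_) ?_ <;>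
  exact Submodule.smul_mem _ _ (Submodule.subset_span (by simp))

/-- Generators of `spl(2,1)`. -/
def splGen : Fin 8 → Matrix (Fin 3) (Fin 3) ℂ :=
  -- In order: the three even elements of sl₂, the element for J or K, and the four odd ones. The
  -- entries -1 account for x² ∂ₓ - ν x and q̄₀ = x ∂ₓ - ν being the negatives of the natural
  -- operators.
  ![!![0, 0, 0; -1, 0, 0; 0, 0, 0], !![0, 1, 0; 0, 0, 0; 0, 0, 0],
    !![-(1 / 2), 0, 0; 0, 1 / 2, 0; 0, 0, 0], !![1 / 2, 0, 0; 0, 1 / 2, 0; 0, 0, 1],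
    !![0, 0, 1; 0, 0, 0; 0, 0, 0], !![0, 0, 0; 0, 0, 1; 0, 0, 0],
    !![0, 0, 0; 0, 0, 0; -1, 0, 0], !![0, 0, 0; 0, 0, 0; 0, 1, 0]]

lemma splGen_supertrace (k : Fin 8) : splGen k 0 0 + splGen k 1 1 - splGen k 2 2 = 0 := by
  fin_cases k <;> simp [splGen]; norm_num

lemma sum_splGen {a : Matrix (Fin 3) (Fin 3) ℂ} (h : a 0 0 + a 1 1 - a 2 2 = 0) :
    ∑ k, (![-a 1 0, a 0 1, a 1 1 - a 0 0, a 2 2, a 0 2, a 1 2, -a 2 0, a 2 1] : Fin 8 → ℂ) k •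
      splGen k = a := by
  refine Matrix.ext fun r s => ?_
  rw [Fin.sum_univ_eight]
  fin_cases r <;> fin_cases s <;> simp [splGen]
  · linear_combination -h / 2
  · linear_combination -h / 2

variable {A : Type} [CommRing A]

lemma qbar_one_zero (i : Fin 2) (ν : A) : qbar i ν 1 0 = -(opC ν - opX A i * opD A i) := by
  simp [qbar]

lemma qbar_self (i : Fin 2) (ν : A) (n : ℕ) : qbar i ν n n = opD A i ^ n := by simp [qbar]

variable [Algebra ℂ A]

/-- The listed images of generators already span the image of the embedding as a vector space,
because the `splGen` span spl(2,1) and the triple spans sl₂. -/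
lemma superIso_superSpan_of_eq [Nontrivial A] {i j : Fin 2} (h : i ≠ j) (ν μ : A)
    {S : Set (MatOp A)} (hS : S = Set.range (fun k => glSuper i ν (splGen k)) ∪
      slDiag j μ '' {slPlus, slMinus, slZero}) :
    SuperIso (superSpan S).carrier (spl21.carrier × SL2) := by
  subst hS
  refine superIso_of_injective (isSuperHom_splEmbedding h ν μ) (splEmbedding_injective h ν μ) ?_ ?_
  · rintro _ (⟨k, rfl⟩ | ⟨b, -, rfl⟩)
    · exact ⟨(⟨splGen k, splGen_supertrace k⟩, 0), by simp [splEmbedding]⟩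
    · exact ⟨(0, b), by simp [splEmbedding]⟩
  · have hsub := subset_superSpan (L := MatOp A)
      (Set.range (fun k => glSuper i ν (splGen k)) ∪ slDiag j μ '' {slPlus, slMinus, slZero})
    rintro _ ⟨⟨⟨a, ha⟩, b⟩, rfl⟩
    refine Submodule.add_mem _ ?_ ?_
    · change glSuper i ν a ∈ _
      rw [← (sum_splGen ha : _ = (a : Matrix (Fin 3) (Fin 3) ℂ))]
      erw [map_sum]
      exact Submodule.sum_mem _ fun k _ => by
        erw [map_smul]
        exact Submodule.smul_mem _ _ (hsub (Or.inl ⟨k, rfl⟩))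
    · have := Submodule.mem_map_of_mem (f := slDiag j μ)
        (span_sl2 ▸ Submodule.mem_top : b ∈ Submodule.span ℂ {slPlus, slMinus, slZero})
      rw [Submodule.map_span] at this
      exact Submodule.span_le.2 (fun x hx => hsub (Or.inr hx)) this

lemma two_mul_C_half_one : (2 * C (algebraMap ℂ A (1 / 2)) : MvPolynomial (Fin 2) A) = 1 := by
  have h := two_mul_C_half (1 : A)
  rwa [half, ← Algebra.algebraMap_eq_smul_one, C_1] at h

lemma C_half (c : A) :
    (C (half c) : MvPolynomial (Fin 2) A) = C (algebraMap ℂ A (1 / 2)) * C c := by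
  rw [half, Algebra.smul_def, C_mul]

lemma neg_one_smul_op (T : PolyOp A) : (-1 : ℂ) • T = -T := by module

lemma glTwo_slPlus (i : Fin 2) (ν : A) : glTwo i ν !![0, 0; -1, 0] = opPlus i ν := by
  simp [glTwo_def, opPlus, neg_one_smul_op]

lemma glTwo_slMinus (i : Fin 2) (ν : A) : glTwo i ν !![0, 1; 0, 0] = opD A i := by
  simp [glTwo_def]

lemma glTwo_slZero (i : Fin 2) (ν : A) :
    glTwo i ν !![-(1 / 2), 0; 0, 1 / 2] = opZero i ν := by
  refine LinearMap.ext fun f => ?_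
  rw [glTwo_apply, opZero, LinearMap.sub_apply, Module.End.mul_apply, opX_apply, opD_apply,
    opC_apply, C_half]
  simp only [Matrix.of_apply, Matrix.cons_val', Matrix.cons_val_zero, Matrix.cons_val_one,
    Matrix.cons_val_fin_one, map_neg, map_zero]
  linear_combination (X i * pderiv i f) * two_mul_C_half_one (A := A)

lemma glTwo_half (i : Fin 2) (ν : A) :
    glTwo i ν !![1 / 2, 0; 0, 1 / 2] = opC (half ν) := by
  refine LinearMap.ext fun f => ?_
  rw [glTwo_apply, opC_apply, C_half]
  simp only [Matrix.of_apply, Matrix.cons_val', Matrix.cons_val_zero, Matrix.cons_val_one,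
    Matrix.cons_val_fin_one, map_zero]
  ring

/-- On the θ component the element diag(1/2, 1/2, 1) acts by (ν - 1)/2 + 1, which is the entry (ν +
1)/2 of J or K. -/
lemma opC_half_sub_one_add (ν : A) : opC (half (ν - 1)) + 1 = opC (half (ν + 1)) := by
  refine LinearMap.ext fun f => ?_
  rw [LinearMap.add_apply, opC_apply, opC_apply, C_half, C_half, C_sub, C_add, C_1,
    Module.End.one_apply]
  linear_combination (-f) * two_mul_C_half_one (A := A)

lemma glSuper_zero_splGen (ν : A) : (fun k => glSuper 0 ν (splGen k)) =
    (![opDiag (opPlus 0 (ν - 1)) (opPlus 0 ν), opDiag (opD A 0) (opD A 0),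
      opDiag (opZero 0 (ν - 1)) (opZero 0 ν), opDiag (opC (half (ν + 1))) (opC (half ν)),
      opDown 1, opDown (opX A 0), opUp (qbar 0 ν 1 0), opUp (opD A 0)] :
      Fin 8 → Matrix (Fin 2) (Fin 2) (PolyOp A)) := by
  refine funext fun k => Matrix.ext fun r s => ?_
  change glSuperEntry 0 ν r s (splGen k) = _
  have hz (μ : A) : glTwo 0 μ !![0, 0; 0, 0] = 0 := by simp [glTwo_def]
  fin_cases k <;> fin_cases r <;> fin_cases s <;>
  simp [splGen, glSuperEntry_apply, opDiag, opUp, opDown, -one_div, hz, glTwo_slPlus,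
    glTwo_slMinus, glTwo_slZero, neg_one_smul_op, glTwo_half, opC_half_sub_one_add, qbar_one_zero]

end Generators

/-! ### The cases (1,0) and (0,1) -/

section Presentations

lemma range_vec_eight {α : Type*} (a b c d e f g h : α) :
    Set.range ![a, b, c, d, e, f, g, h] = {a, b, c, d, e, f, g, h} := by
  ext x
  simp [eq_comm]
  tauto

lemma set_rearrange {α : Type*} (a b c a' b' c' j p q r s : α) :
    ({a, b, c, a', b', c'} ∪ {j} ∪ {p, q, r, s} : Set α) =
      {a, b, c, j, p, q, r, s} ∪ {a', b', c'} := by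
  ext x
  simp only [Set.mem_union, Set.mem_insert_iff, Set.mem_singleton_iff]
  tauto

lemma set_swap_triples {α : Type*} (a b c a' b' c' : α) :
    ({a, b, c, a', b', c'} : Set α) = {a', b', c', a, b, c} := by
  ext x
  simp only [Set.mem_insert_iff, Set.mem_singleton_iff]
  tauto

lemma union_pair_union {α : Type*} (S T : Set α) (a b : α) :
    S ∪ {a, b} ∪ T = insert b (S ∪ {a} ∪ T) := by
  ext x
  simp only [Set.mem_union, Set.mem_insert_iff, Set.mem_singleton_iff]
  tauto

variable {A : Type} [CommRing A]

lemma gensQ_one_zero (ν μ : A) : gensQ 1 0 ν μ =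
    {opDown 1, opDown (opX A 0), opUp (qbar 0 ν 1 0), opUp (opD A 0)} := by
  ext Q
  constructor
  · rintro ⟨α, β, hα, hβ, h⟩
    obtain rfl : β = 0 := by omega
    interval_cases α <;> rcases h with rfl | rfl <;> simp [qbar_self]
  · rintro (rfl | rfl | rfl | rfl)
    exacts [⟨0, 0, by simp [qbar_self]⟩, ⟨1, 0, by simp [qbar_self]⟩, ⟨0, 0, by simp⟩,
      ⟨1, 0, by simp [qbar_self]⟩]

lemma gensQ_zero_one (ν μ : A) : gensQ 0 1 ν μ =
    {opUp 1, opUp (opX A 1), opDown (qbar 1 μ 1 0), opDown (opD A 1)} := by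
  ext Q
  constructor
  · rintro ⟨α, β, hα, hβ, h⟩
    obtain rfl : α = 0 := by omega
    interval_cases β <;> rcases h with rfl | rfl <;> simp [qbar_self]
  · rintro (rfl | rfl | rfl | rfl)
    exacts [⟨0, 0, by simp [qbar_self]⟩, ⟨0, 1, by simp [qbar_self]⟩, ⟨0, 0, by simp⟩,
      ⟨0, 1, by simp [qbar_self]⟩]

lemma gensQ_zero_zero (ν μ : A) : gensQ 0 0 ν μ = {opDown 1, opUp 1} := by
  ext Q
  constructor
  · rintro ⟨α, β, hα, hβ, h⟩
    obtain rfl : α = 0 := by omega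
    obtain rfl : β = 0 := by omega
    rcases h with rfl | rfl <;> simp [qbar_self]
  · rintro (rfl | rfl)
    exacts [⟨0, 0, by simp [qbar_self]⟩, ⟨0, 0, by simp [qbar_self]⟩]

variable [Algebra ℂ A]

/-- The θ component is now the lower right entry, so the roles of σ⁺ and σ⁻ are exchanged. -/
lemma glSuper_one_splGen (ν : A) : (fun k => glSuper 1 ν (splGen k)) =
    (![opDiag (opPlus 1 ν) (opPlus 1 (ν - 1)), opDiag (opD A 1) (opD A 1),
      opDiag (opZero 1 ν) (opZero 1 (ν - 1)), opDiag (opC (half ν)) (opC (half (ν + 1))),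
      opUp 1, opUp (opX A 1), opDown (qbar 1 ν 1 0), opDown (opD A 1)] :
      Fin 8 → Matrix (Fin 2) (Fin 2) (PolyOp A)) := by
  refine funext fun k => Matrix.ext fun r s => ?_
  change glSuperEntry 1 ν r s (splGen k) = _
  have hz (μ : A) : glTwo 1 μ !![0, 0; 0, 0] = 0 := by simp [glTwo_def]
  fin_cases k <;> fin_cases r <;> fin_cases s <;>
  simp [splGen, glSuperEntry_apply, opDiag, opUp, opDown, -one_div, hz, glTwo_slPlus,
    glTwo_slMinus, glTwo_slZero, neg_one_smul_op, glTwo_half, opC_half_sub_one_add, qbar_one_zero]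

lemma image_slDiag (i : Fin 2) (ν : A) : slDiag i ν '' {slPlus, slMinus, slZero} =
    ({opDiag (opPlus i ν) (opPlus i ν), opDiag (opD A i) (opD A i),
      opDiag (opZero i ν) (opZero i ν)} : Set (Matrix (Fin 2) (Fin 2) (PolyOp A))) := by
  rw [Set.image_insert_eq, Set.image_insert_eq, Set.image_singleton, slDiag_apply, slDiag_apply,
    slDiag_apply, ← glTwo_slPlus, ← glTwo_slMinus i ν, ← glTwo_slZero]
  rfl

lemma generators_one_zero (ν μ : A) : gensST 1 0 ν μ ∪ {genJ 1 ν} ∪ gensQ 1 0 ν μ =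
    Set.range (fun k => glSuper 0 ν (splGen k)) ∪ slDiag 1 μ '' {slPlus, slMinus, slZero} := by
  have h := set_rearrange (opDiag (opPlus 0 (ν - 1)) (opPlus 0 ν)) (opDiag (opD A 0) (opD A 0))
    (opDiag (opZero 0 (ν - 1)) (opZero 0 ν)) (opDiag (opPlus 1 μ) (opPlus 1 μ))
    (opDiag (opD A 1) (opD A 1)) (opDiag (opZero 1 μ) (opZero 1 μ))
    (opDiag (opC (half (ν + 1))) (opC (half ν))) (opDown 1) (opDown (opX A 0))
    (opUp (qbar 0 ν 1 0)) (opUp (opD A 0))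
  rw [← range_vec_eight, ← glSuper_zero_splGen, ← gensQ_one_zero ν μ] at h
  rw [gensST, genJ, Nat.cast_one, Nat.cast_zero, sub_zero]
  exact h.trans (congrArg (Set.range (fun k => glSuper 0 ν (splGen k)) ∪ ·)
    (image_slDiag 1 μ).symm)

lemma generators_zero_one (ν μ : A) : gensST 0 1 ν μ ∪ {genK 1 μ} ∪ gensQ 0 1 ν μ =
    Set.range (fun k => glSuper 1 μ (splGen k)) ∪ slDiag 0 ν '' {slPlus, slMinus, slZero} := by
  have h := set_rearrange (opDiag (opPlus 1 μ) (opPlus 1 (μ - 1))) (opDiag (opD A 1) (opD A 1))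
    (opDiag (opZero 1 μ) (opZero 1 (μ - 1))) (opDiag (opPlus 0 ν) (opPlus 0 ν))
    (opDiag (opD A 0) (opD A 0)) (opDiag (opZero 0 ν) (opZero 0 ν))
    (opDiag (opC (half μ)) (opC (half (μ + 1)))) (opUp 1) (opUp (opX A 1))
    (opDown (qbar 1 μ 1 0)) (opDown (opD A 1))
  rw [← range_vec_eight, ← glSuper_one_splGen, ← gensQ_zero_one ν μ, set_swap_triples] at h
  rw [gensST, genK, Nat.cast_one, Nat.cast_zero, sub_zero]
  exact h.trans (congrArg (Set.range (fun k => glSuper 1 μ (splGen k)) ∪ ·)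
    (image_slDiag 0 ν).symm)

lemma superIso_superS10 [Nontrivial A] (ν μ : A) :
    SuperIso (superS10 ν μ).carrier (spl21.carrier × SL2) :=
  superIso_superSpan_of_eq zero_ne_one ν μ (generators_one_zero ν μ)

lemma superIso_superS01 [Nontrivial A] (ν μ : A) :
    SuperIso (superS01 ν μ).carrier (spl21.carrier × SL2) :=
  superIso_superSpan_of_eq one_ne_zero μ ν (generators_zero_one ν μ)

instance : FiniteDimensional ℂ (SuperMatrix parity21 ℂ) :=
  inferInstanceAs (FiniteDimensional ℂ (Matrix (Fin 3) (Fin 3) ℂ))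

lemma SuperIso.finiteDimensional {L M : Type*} [AddCommGroup L] [Module ℂ L] [LieSuperalgebra L]
    [AddCommGroup M] [Module ℂ M] [LieSuperalgebra M] [FiniteDimensional ℂ M]
    (h : SuperIso L M) : FiniteDimensional ℂ L := by
  obtain ⟨e, -⟩ := h
  exact e.symm.finiteDimensional

lemma sbr_opDiag_opC_eq_zero (c : A) (M : MatOp A) :
    sbr (L := MatOp A) (opDiag (opC c) (opC c)) M = 0 :=
  sbr_opDiag_self_eq_zero fun _ _ => (opC_commute _ _).symm

lemma genJ_zero (ν : A) : genJ 0 ν = opDiag (opC (half ν)) (opC (half ν)) := by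
  rw [genJ, Nat.cast_zero, add_zero]

lemma genK_zero (μ : A) : genK 0 μ = opDiag (opC (half μ)) (opC (half μ)) := by
  rw [genK, Nat.cast_zero, add_zero]

lemma finiteDimensional_superS_one_zero [Nontrivial A] (ν μ : A) :
    FiniteDimensional ℂ (superS 1 0 ν μ).carrier := by
  refine finiteDimensional_superSpan_of_eq_insert (L := MatOp A)
    (union_pair_union (gensST 1 0 ν μ) _ _ _) (superIso_superS10 ν μ).finiteDimensional ?_ ?_
  · exact opDiag_mem_even _ _
  · rw [genK_zero]
    exact sbr_opDiag_opC_eq_zero _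

lemma finiteDimensional_superS_zero_one [Nontrivial A] (ν μ : A) :
    FiniteDimensional ℂ (superS 0 1 ν μ).carrier := by
  refine finiteDimensional_superSpan_of_eq_insert (L := MatOp A)
    -- Here J is the scalar one, so the pair is reversed before the central element is split off.
    ((congrArg (fun T => gensST 0 1 ν μ ∪ T ∪ gensQ 0 1 ν μ) (Set.pair_comm _ _)).trans
    (union_pair_union (gensST 0 1 ν μ) _ _ _)) (superIso_superS01 ν μ).finiteDimensional ?_ ?_
  · exact opDiag_mem_even _ _
  · rw [genJ_zero]
    exact sbr_opDiag_opC_eq_zero _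

end Presentations

/-! ### Infinite dimension for Δ + Γ ≥ 2 -/

section InfiniteDimensional

open MvPolynomial

variable {A : Type} [CommRing A]

/-- N is a product of a consecutive positive integers; only its being nonzero matters later. -/
lemma exists_coeff_opD_pow (i : Fin 2) (a : ℕ) (m : Fin 2 →₀ ℕ) :
    ∃ N : ℕ, N ≠ 0 ∧ ∀ f : MvPolynomial (Fin 2) A,
      coeff m ((opD A i ^ a) f) = N * coeff (m + Finsupp.single i a) f := by
  induction a with
  | zero => exact ⟨1, one_ne_zero, fun f => by simp⟩
  | succ a ih =>
    obtain ⟨N, hN, h⟩ := ih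
    refine ⟨N * ((m + Finsupp.single i a) i + 1), mul_ne_zero hN (Nat.succ_ne_zero _), fun f => ?_⟩
    rw [pow_succ, Module.End.mul_apply, h, opD_apply, coeff_pderiv, add_assoc,
      ← Finsupp.single_add]
    push_cast
    ring

lemma exists_coeff_opD_pow_mul (i j : Fin 2) (a b : ℕ) :
    ∃ N : ℕ, N ≠ 0 ∧ ∀ f : MvPolynomial (Fin 2) A,
      coeff 0 ((opD A i ^ a * opD A j ^ b) f) =
        N * coeff (Finsupp.single i a + Finsupp.single j b) f := by
  obtain ⟨N, hN, h⟩ := exists_coeff_opD_pow (A := A) i a 0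
  obtain ⟨M, hM, h'⟩ := exists_coeff_opD_pow (A := A) j b (0 + Finsupp.single i a)
  refine ⟨N * M, mul_ne_zero hN hM, fun f => ?_⟩
  rw [Module.End.mul_apply, h, h', zero_add]
  push_cast
  ring

/-- Iterates the Weyl relation ∂ x = x ∂ + 1. -/
lemma opD_pow_succ_mul_opX (i : Fin 2) (a : ℕ) :
    opD A i ^ (a + 1) * opX A i - opX A i * opD A i ^ (a + 1) =
      ((a + 1 : ℕ) : PolyOp A) * opD A i ^ a := by
  have h1 : opD A i * opX A i = opX A i * opD A i + 1 := LinearMap.ext fun f => by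
    simp [opX_apply, opD_apply, add_comm]
  induction a with
  | zero => simp [h1]
  | succ a ih =>
    have h := sub_eq_iff_eq_add.1 ih
    rw [pow_succ' _ (a + 1), mul_assoc, h, mul_add, ← mul_assoc _ (opX A i), h1,
      (Nat.cast_commute (a + 1) (opD A i)).symm.left_comm, ← pow_succ']
    push_cast
    noncomm_ring

/-- The commutator of a product of derivatives with an operator of degree one in the variable. -/
lemma opD_pow_commutator {i j : Fin 2} (h : i ≠ j) (a b : ℕ) {V V' : PolyOp A}
    (hV : ∀ k, Commute (opD A k) V) (hV' : ∀ k, Commute (opD A k) V') :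
    opD A i ^ (a + 1) * opD A j ^ b * (V * opX A i * V') -
      V * opX A i * V' * (opD A i ^ (a + 1) * opD A j ^ b) =
      ((a + 1 : ℕ) : PolyOp A) * (opD A i ^ a * opD A j ^ b * (V * V')) := by
  have hW : ∀ {U : PolyOp A}, (∀ k, Commute (opD A k) U) → ∀ a b,
      Commute (opD A i ^ a * opD A j ^ b) U :=
    fun hU a b => ((hU i).pow_left a).mul_left ((hU j).pow_left b)
  have hX : Commute (opD A j ^ b) (opX A i) := (opX_commute_opD h).symm.pow_left b
  have key : opD A i ^ (a + 1) * opD A j ^ b * opX A i -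
      opX A i * (opD A i ^ (a + 1) * opD A j ^ b) =
      ((a + 1 : ℕ) : PolyOp A) * (opD A i ^ a * opD A j ^ b) := by
    rw [mul_assoc, hX.eq, ← mul_assoc, ← mul_assoc, ← sub_mul, opD_pow_succ_mul_opX, mul_assoc]
  -- The derivatives commute with V and V', so the commutator only sees the factor x_i between them.
  calc _ = V * (opD A i ^ (a + 1) * opD A j ^ b * opX A i -
      opX A i * (opD A i ^ (a + 1) * opD A j ^ b)) * V' := by
        have hWV := (hW hV (a + 1) b).eq
        have hWV' := (hW hV' (a + 1) b).eq
        generalize opD A i ^ (a + 1) * opD A j ^ b = W at hWV hWV'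
        rw [mul_sub, sub_mul, mul_assoc (V * opX A i), ← hWV']
        simp only [← mul_assoc, hWV]
    _ = _ := by
        have hWV := (hW hV a b).eq
        rw [key]
        generalize opD A i ^ a * opD A j ^ b = W at hWV
        rw [(Nat.cast_commute (a + 1) V).symm.left_comm, ← hWV]
        simp only [mul_assoc]

variable [Algebra ℂ A]

/-- Both matrices are odd, so their bracket is the anticommutator. -/
lemma superCommutator_opDown_opUp (S T : PolyOp A) :
    superCommutator parity11 (opDown S) (opUp T) = opDiag (T * S) (S * T) := by
  refine Matrix.ext fun r s => ?_
  have h11 : (1 : ZMod 2) + 1 = 0 := by decide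
  simp only [superCommutator_apply, Fin.sum_univ_two]
  fin_cases r <;> fin_cases s <;> simp [parity11, superSign, opDiag, opUp, opDown, h11]

lemma opDiag_mem_of_opDown_opUp (s : LieSubsuperalgebra (MatOp A)) {S T : PolyOp A}
    (hS : (opDown S : MatOp A) ∈ s.carrier) (hT : (opUp T : MatOp A) ∈ s.carrier) :
    (opDiag (T * S) (S * T) : MatOp A) ∈ s.carrier := by
  have h := s.sbr_closed hS hT
  exact (superCommutator_opDown_opUp S T) ▸ h

/-- A graded subalgebra that contains suitable operators of degree zero and one in a variable
contains operators of arbitrarily high order. -/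
lemma opDiag_pow_mem (s : LieSubsuperalgebra (MatOp A)) {i j : Fin 2} (h : i ≠ j) {d e : ℕ}
    {V V' U U' : PolyOp A} (hV : ∀ k, Commute (opD A k) V) (hV' : ∀ k, Commute (opD A k) V')
    (hU : ∀ k, Commute (opD A k) U) (hU' : ∀ k, Commute (opD A k) U')
    (hVV : V * V' = opD A i ^ (d + 1) * opD A j ^ e)
    (hUU : U * U' = opD A i ^ (d + 1) * opD A j ^ e)
    (h0 : (opDiag (opD A i ^ (d + 1) * opD A j ^ e) (opD A i ^ (d + 1) * opD A j ^ e) : MatOp A) ∈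
      s.carrier)
    (h1 : (opDiag (V * opX A i * V') (U * opX A i * U') : MatOp A) ∈ s.carrier) (k : ℕ) :
    (opDiag (opD A i ^ ((k + 1) * d + 1) * opD A j ^ ((k + 1) * e))
      (opD A i ^ ((k + 1) * d + 1) * opD A j ^ ((k + 1) * e)) : MatOp A) ∈ s.carrier := by
  induction k with
  | zero => simpa using h0
  | succ k ih =>
    have hpow : opD A i ^ ((k + 1) * d) * opD A j ^ ((k + 1) * e) *
        (opD A i ^ (d + 1) * opD A j ^ e) =
        opD A i ^ ((k + 1 + 1) * d + 1) * opD A j ^ ((k + 1 + 1) * e) := by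
      rw [((opD_commute_opD j i).pow_pow _ _).mul_mul_mul_comm, ← pow_add, ← pow_add]
      ring_nf
    -- The bracket raises the exponents by (d, e) in both diagonal entries, with the same factor (k
    -- + 1) d + 1, which is invertible in ℂ.
    have hs := s.sbr_closed ih h1
    have heq : superCommutator parity11
        (opDiag (opD A i ^ ((k + 1) * d + 1) * opD A j ^ ((k + 1) * e))
          (opD A i ^ ((k + 1) * d + 1) * opD A j ^ ((k + 1) * e)))
        (opDiag (V * opX A i * V') (U * opX A i * U')) =
        ((((k + 1) * d + 1 : ℕ) : ℂ)) •
        opDiag (opD A i ^ ((k + 1 + 1) * d + 1) * opD A j ^ ((k + 1 + 1) * e))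
          (opD A i ^ ((k + 1 + 1) * d + 1) * opD A j ^ ((k + 1 + 1) * e)) := by
      refine Matrix.ext fun r s => ?_
      rw [sbr_opDiag_self]
      have hc : ∀ (n : ℕ) (T : PolyOp A), (n : ℂ) • T = (n : PolyOp A) * T := fun n T => by
        rw [Nat.cast_smul_eq_nsmul, nsmul_eq_mul]
      fin_cases r <;> fin_cases s
      · simp only [opDiag, Fin.zero_eta, Matrix.of_apply, Matrix.cons_val', Matrix.cons_val_zero,
          Matrix.cons_val_fin_one, Matrix.smul_apply]
        rw [opD_pow_commutator h _ _ hV hV', hVV, hpow, hc]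
      · simp [opDiag]
      · simp [opDiag]
      · simp only [opDiag, Fin.mk_one, Matrix.of_apply, Matrix.cons_val', Matrix.cons_val_one,
          Matrix.cons_val_fin_one, Matrix.smul_apply]
        rw [opD_pow_commutator h _ _ hU hU', hUU, hpow, hc]
    have hne : ((((k + 1) * d + 1 : ℕ) : ℂ)) ≠ 0 := Nat.cast_ne_zero.2 (Nat.succ_ne_zero _)
    refine (s.carrier.smul_mem_iff hne).1 ?_
    convert hs using 1
    exact heq.symm

/-- The upper left entry. -/
def upperLeft (A : Type) [CommRing A] [Algebra ℂ A] : MatOp A →ₗ[ℂ] PolyOp A where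
  toFun M := M 0 0
  map_add' _ _ := rfl
  map_smul' _ _ := rfl

variable [Nontrivial A]

/-- The exponents are pairwise distinct because (d, e) ≠ (0, 0). The constant term of the k-th
operator applied to the l-th monomial is nonzero exactly for k = l. -/
lemma linearIndependent_opD_pow {i j : Fin 2} (h : i ≠ j) {d e : ℕ} (hde : d ≠ 0 ∨ e ≠ 0) :
    LinearIndependent ℂ (fun k : ℕ =>
      opD A i ^ ((k + 1) * d + 1) * opD A j ^ ((k + 1) * e)) := by
  let p : ℕ → Fin 2 →₀ ℕ := fun k =>
    Finsupp.single i ((k + 1) * d + 1) + Finsupp.single j ((k + 1) * e)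
  have hp : Function.Injective p := by
    intro k l hkl
    have hi := DFunLike.congr_fun hkl i
    have hj := DFunLike.congr_fun hkl j
    simp only [p, Finsupp.add_apply, Finsupp.single_eq_same, Finsupp.single_eq_of_ne h,
      Finsupp.single_eq_of_ne h.symm, add_zero, zero_add] at hi hj
    rcases hde with hd | he
    · exact Nat.succ_injective (Nat.eq_of_mul_eq_mul_right (Nat.pos_of_ne_zero hd)
        (Nat.succ_injective hi))
    · exact Nat.succ_injective (Nat.eq_of_mul_eq_mul_right (Nat.pos_of_ne_zero he) hj)
  rw [linearIndependent_iff']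
  intro t c hc l hl
  have hcoeff := congrArg (coeff 0) (LinearMap.congr_fun hc (monomial (p l) (1 : A)))
  rw [LinearMap.sum_apply, coeff_sum, Finset.sum_eq_single_of_mem l hl] at hcoeff
  · obtain ⟨N, hN, hf⟩ := exists_coeff_opD_pow_mul (A := A) i j ((l + 1) * d + 1) ((l + 1) * e)
    rw [LinearMap.smul_apply, coeff_smul, hf, coeff_monomial, if_pos rfl, mul_one,
      LinearMap.zero_apply, coeff_zero, Algebra.smul_def, ← map_natCast (algebraMap ℂ A),
      ← map_mul, map_eq_zero] at hcoeff
    exact (mul_eq_zero.1 hcoeff).resolve_right (Nat.cast_ne_zero.2 hN)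
  · intro k _ hkl
    obtain ⟨N, -, hf⟩ := exists_coeff_opD_pow_mul (A := A) i j ((k + 1) * d + 1) ((k + 1) * e)
    rw [LinearMap.smul_apply, coeff_smul, hf, coeff_monomial, if_neg fun hpl => hkl (hp hpl).symm,
      mul_zero, smul_zero]

lemma not_finiteDimensional_of_opDiag_pow_mem (s : LieSubsuperalgebra (MatOp A)) {i j : Fin 2}
    (h : i ≠ j) {d e : ℕ} (hde : d ≠ 0 ∨ e ≠ 0)
    (hs : ∀ k : ℕ, (opDiag (opD A i ^ ((k + 1) * d + 1) * opD A j ^ ((k + 1) * e))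
      (opD A i ^ ((k + 1) * d + 1) * opD A j ^ ((k + 1) * e)) : MatOp A) ∈ s.carrier) :
    ¬ FiniteDimensional ℂ s.carrier := by
  intro hfin
  have hli : LinearIndependent ℂ (fun k => (⟨_, hs k⟩ : s.carrier)) :=
    LinearIndependent.of_comp (upperLeft A ∘ₗ s.carrier.subtype) (linearIndependent_opD_pow h hde)
  exact not_finite_iff_infinite.2 (inferInstance : Infinite ℕ) hli.finite

lemma not_finiteDimensional_superS (Δ Γ : ℕ) (ν μ : A) (h : 2 ≤ Δ + Γ) :
    ¬ FiniteDimensional ℂ (superS Δ Γ ν μ).carrier := by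
  have hQ : ∀ Q, Q ∈ gensQ Δ Γ ν μ → (Q : MatOp A) ∈ (superS Δ Γ ν μ).carrier :=
    fun Q hQ => subset_superSpan (L := MatOp A) _ (Or.inr hQ)
  have hdown : ∀ α, α ≤ Δ → (opDown (opX A 0 ^ α * opD A 1 ^ Γ) : MatOp A) ∈
      (superS Δ Γ ν μ).carrier := fun α hα =>
    hQ _ ⟨α, Γ, hα, le_rfl, Or.inl (by rw [qbar_self])⟩
  have hup : ∀ β, β ≤ Γ → (opUp (opD A 0 ^ Δ * opX A 1 ^ β) : MatOp A) ∈
      (superS Δ Γ ν μ).carrier := fun β hβ =>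
    hQ _ ⟨Δ, β, le_rfl, hβ, Or.inr (by rw [qbar_self])⟩
  have hcomm : ∀ i k a, Commute (opD A k) (opD A i ^ a) :=
    fun i k a => (opD_commute_opD k i).pow_right a
  have hD := ((opD_commute_opD (A := A) 0 1).pow_pow Δ Γ).eq
  rcases Δ with _ | d
  -- For Δ = 0 the growing variable is y, and Q⁻₀Γ, Q⁺₀₁ give diag(y ∂_y^Γ, ∂_y^Γ y).
  · obtain ⟨e, rfl⟩ : ∃ e, Γ = e + 1 := ⟨Γ - 1, by omega⟩
    refine not_finiteDimensional_of_opDiag_pow_mem _ one_ne_zero (d := e) (e := 0)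
      (Or.inl (by omega)) (opDiag_pow_mem _ one_ne_zero (V := 1) (V' := opD A 1 ^ (e + 1))
        (U := opD A 1 ^ (e + 1)) (U' := 1) (fun k => Commute.one_right _) (hcomm 1 · _)
        (hcomm 1 · _) (fun k => Commute.one_right _) (by simp) (by simp) ?_ ?_)
    · simpa using opDiag_mem_of_opDown_opUp _ (hdown 0 (Nat.zero_le _)) (hup 0 (Nat.zero_le _))
    · simpa using opDiag_mem_of_opDown_opUp _ (hdown 0 (Nat.zero_le _)) (hup 1 (by omega))
  -- For Δ ≥ 1, Q⁻₁Γ and Q⁺_Δ0 give diag(∂ₓ^Δ x ∂_y^Γ, x ∂_y^Γ ∂ₓ^Δ).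
  · refine not_finiteDimensional_of_opDiag_pow_mem _ zero_ne_one (d := d) (e := Γ) (by omega)
      (opDiag_pow_mem _ zero_ne_one (V := opD A 0 ^ (d + 1)) (V' := opD A 1 ^ Γ)
        (U := 1) (U' := opD A 1 ^ Γ * opD A 0 ^ (d + 1)) (hcomm 0 · _) (hcomm 1 · _)
        (fun k => Commute.one_right _) (fun k => (hcomm 1 k _).mul_right (hcomm 0 k _)) rfl
        (by rw [one_mul, hD]) ?_ ?_)
    · have := opDiag_mem_of_opDown_opUp _ (hdown 0 (Nat.zero_le _)) (hup 0 (Nat.zero_le _))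
      simpa [← hD] using this
    · have := opDiag_mem_of_opDown_opUp _ (hdown 1 (by omega)) (hup 0 (Nat.zero_le _))
      simpa [mul_assoc] using this

end InfiniteDimensional

/-! ### Finite dimension for Δ = Γ = 0 -/

section CaseZeroZero

variable {A : Type} [CommRing A] [Algebra ℂ A]

/-- The constant matrices among the matrix operators. -/
def constEmbedding (A : Type) [CommRing A] [Algebra ℂ A] :
    SuperMatrix parity11 ℂ →ₗ[ℂ] MatOp A :=
  ((Algebra.linearMap ℂ (PolyOp A)).mapMatrix :
    Matrix (Fin 2) (Fin 2) ℂ →ₗ[ℂ] Matrix (Fin 2) (Fin 2) (PolyOp A))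

lemma isSuperHom_constEmbedding : IsSuperHom (constEmbedding A) where
  map_sbr := by
    intro (a : Matrix (Fin 2) (Fin 2) ℂ) (b : Matrix (Fin 2) (Fin 2) ℂ)
    refine Matrix.ext fun r s => ?_
    change algebraMap ℂ (PolyOp A) (superCommutator parity11 a b r s) = superCommutator parity11
      (a.map (algebraMap ℂ (PolyOp A))) (b.map (algebraMap ℂ (PolyOp A))) r s
    simp only [superCommutator_apply, map_sum, map_sub, map_mul, Matrix.map_apply,
      Algebra.smul_def, Algebra.algebraMap_self, RingHom.id_apply]
  map_homog := by
    intro k (a : Matrix (Fin 2) (Fin 2) ℂ) ha r s h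
    change algebraMap ℂ (PolyOp A) (a r s) = 0
    rw [ha r s h, map_zero]

lemma commute_constEmbedding (T : PolyOp A) (a : Matrix (Fin 2) (Fin 2) ℂ) (r s : Fin 2) :
    Commute T (constEmbedding A a r s) :=
  (Algebra.commutes (a r s) T).symm

lemma isSuperHom_coprod_zero_zero (ν μ : A) :
    IsSuperHom (((constEmbedding A).coprod (slDiag 0 ν)).coprod (slDiag 1 μ)) := by
  refine (isSuperHom_constEmbedding.coprod (isSuperHom_slDiag 0 ν) (fun b => opDiag_mem_even _ _)
    fun a b => sbr_opDiag_self_eq_zero fun r s => commute_constEmbedding _ a r s).coprod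
    (isSuperHom_slDiag 1 μ) (fun b => opDiag_mem_even _ _) ?_
  rintro ⟨a, b⟩ c
  rw [LinearMap.coprod_apply, map_add]
  rw [show sbr (slDiag 1 μ c) (constEmbedding A a) = 0 from
    sbr_opDiag_self_eq_zero fun r s => commute_constEmbedding _ a r s, zero_add]
  refine sbr_opDiag_self_eq_zero fun r s => ?_
  have h := glTwo_commute_glTwo (zero_ne_one' (Fin 2)) ν μ b.1 c.1
  fin_cases r <;> fin_cases s
  exacts [h.symm, Commute.zero_right _, Commute.zero_right _, h.symm]

lemma insert_triple_eq_union {α : Type*} (a b c a' b' c' : α) :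
    ({a, b, c, a', b', c'} : Set α) = {a, b, c} ∪ {a', b', c'} := by
  ext x
  simp only [Set.mem_union, Set.mem_insert_iff, Set.mem_singleton_iff]
  tauto

lemma gensST_zero_zero (ν μ : A) : gensST 0 0 ν μ = slDiag 0 ν '' {slPlus, slMinus, slZero} ∪
    slDiag 1 μ '' {slPlus, slMinus, slZero} := by
  rw [gensST, Nat.cast_zero, sub_zero, sub_zero, insert_triple_eq_union]
  exact congrArg₂ (· ∪ ·) (image_slDiag 0 ν).symm (image_slDiag 1 μ).symm

lemma constEmbedding_down : constEmbedding A (!![0, 0; 1, 0] : Matrix (Fin 2) (Fin 2) ℂ) =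
    opDown 1 := by
  refine Matrix.ext fun r s => ?_
  change algebraMap ℂ (PolyOp A) ((!![0, 0; 1, 0] : Matrix (Fin 2) (Fin 2) ℂ) r s) = _
  fin_cases r <;> fin_cases s <;> simp [opDown]

lemma constEmbedding_up : constEmbedding A (!![0, 1; 0, 0] : Matrix (Fin 2) (Fin 2) ℂ) =
    opUp 1 := by
  refine Matrix.ext fun r s => ?_
  change algebraMap ℂ (PolyOp A) ((!![0, 1; 0, 0] : Matrix (Fin 2) (Fin 2) ℂ) r s) = _
  fin_cases r <;> fin_cases s <;> simp [opUp]

lemma generators_zero_zero (ν μ : A) : ∀ Q ∈ gensST 0 0 ν μ ∪ gensQ 0 0 ν μ,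
    (Q : MatOp A) ∈
      LinearMap.range (((constEmbedding A).coprod (slDiag 0 ν)).coprod (slDiag 1 μ)) := by
  rw [gensQ_zero_zero, gensST_zero_zero]
  rintro _ ((⟨a, -, rfl⟩ | ⟨a, -, rfl⟩) | rfl | rfl)
  · exact ⟨((0, a), 0), by simp⟩
  · exact ⟨((0, 0), a), by simp⟩
  · exact ⟨(((!![0, 0; 1, 0] : Matrix (Fin 2) (Fin 2) ℂ), 0), 0), by
      rw [LinearMap.coprod_apply, LinearMap.coprod_apply, map_zero, map_zero, add_zero, add_zero]
      exact constEmbedding_down⟩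
  · exact ⟨(((!![0, 1; 0, 0] : Matrix (Fin 2) (Fin 2) ℂ), 0), 0), by
      rw [LinearMap.coprod_apply, LinearMap.coprod_apply, map_zero, map_zero, add_zero, add_zero]
      exact constEmbedding_up⟩

instance : FiniteDimensional ℂ (SuperMatrix parity11 ℂ) :=
  inferInstanceAs (FiniteDimensional ℂ (Matrix (Fin 2) (Fin 2) ℂ))

/-- S, T and Q lie in the image of gl(1,1) ⊕ sl₂ ⊕ sl₂, and J, K are scalars adjoined one after the
other. -/
lemma finiteDimensional_superS_zero_zero (ν μ : A) :
    FiniteDimensional ℂ (superS 0 0 ν μ).carrier := by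
  have hfin : FiniteDimensional ℂ (isSuperHom_coprod_zero_zero ν μ).range.carrier :=
    LinearMap.finiteDimensional_range (((constEmbedding A).coprod (slDiag 0 ν)).coprod (slDiag 1 μ))
  have h0 : FiniteDimensional ℂ
      (superSpan (L := MatOp A) (gensST 0 0 ν μ ∪ gensQ 0 0 ν μ)).carrier :=
    Submodule.finiteDimensional_of_le
      (superSpan_le (s := (isSuperHom_coprod_zero_zero ν μ).range) (generators_zero_zero ν μ))
  have h1 := finiteDimensional_superSpan_of_eq_insert (L := MatOp A) rfl h0
    (opDiag_mem_even (opC (half ν)) (opC (half ν))) (sbr_opDiag_opC_eq_zero _)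
  refine finiteDimensional_superSpan_of_eq_insert (L := MatOp A) ?_ h1
    (opDiag_mem_even (opC (half μ)) (opC (half μ))) (sbr_opDiag_opC_eq_zero _)
  refine Eq.trans ?_ (congrArg (insert _) (Set.insert_union (α := MatOp A)))
  refine (union_pair_union (gensST 0 0 ν μ) _ _ _).trans ?_
  rw [genJ_zero, genK_zero, Set.union_singleton]
  rfl

end CaseZeroZero

/-! ### The Lie algebra for Δ = Γ = 0 -/

section LieCase

attribute [local instance] LieRing.ofAssociativeRing

variable {A : Type} [CommRing A] [Algebra ℂ A]

lemma mul_sub_mul_of_commute {R : Type*} [Ring R] {x y x' y' : R} (h : Commute x y')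
    (h' : Commute x' y) :
    (x + y) * (x' + y') - (x' + y') * (x + y) = (x * x' - x' * x) + (y * y' - y' * y) := by
  rw [add_mul, mul_add, mul_add, add_mul, mul_add, mul_add, h.eq, h'.eq]
  abel

/-- The embedding of `sl₂ ⊕ sl₂ ⊕ sl₂`. -/
def sl2CubedEmbedding (ν μ : A) : SL2 × SL2 × SL2 →ₗ⁅ℂ⁆ Matrix (Fin 2) (Fin 2) (PolyOp A) where
  toFun t := Matrix.scalar (Fin 2) (glTwo 0 ν t.1.1 + glTwo 1 μ t.2.1.1) +
    (algebraMap ℂ (PolyOp A)).mapMatrix t.2.2.1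
  map_add' t t' := by
    change Matrix.scalar (Fin 2) (glTwo 0 ν (t.1.1 + t'.1.1) + glTwo 1 μ (t.2.1.1 + t'.2.1.1)) +
      (algebraMap ℂ (PolyOp A)).mapMatrix (t.2.2.1 + t'.2.2.1) = _
    simp only [map_add]
    abel
  map_smul' c t := by
    change Matrix.scalar (Fin 2) (glTwo 0 ν (c • t.1.1) + glTwo 1 μ (c • t.2.1.1)) +
      (algebraMap ℂ (PolyOp A)).mapMatrix (c • t.2.2.1) = c • _
    refine Matrix.ext fun r s => ?_
    have h : ∀ z : ℂ, algebraMap ℂ (PolyOp A) (c * z) = c • algebraMap ℂ (PolyOp A) z := fun z => by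
      rw [map_mul, Algebra.smul_def]
    fin_cases r <;> fin_cases s <;> simp [-map_mul, h]
  map_lie' := by
    rintro ⟨a, b, c⟩ ⟨a', b', c'⟩
    have hc : ∀ (T : PolyOp A) (c : Matrix (Fin 2) (Fin 2) ℂ),
        Commute (Matrix.scalar (Fin 2) T) ((algebraMap ℂ (PolyOp A)).mapMatrix c) := fun T c =>
      Matrix.ext fun r s => by
        simpa [Matrix.scalar_apply] using (Algebra.commutes (c r s) T).symm
    change Matrix.scalar (Fin 2) (glTwo 0 ν (a.1 * a'.1 - a'.1 * a.1) +
        glTwo 1 μ (b.1 * b'.1 - b'.1 * b.1)) +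
      (algebraMap ℂ (PolyOp A)).mapMatrix (c.1 * c'.1 - c'.1 * c.1) = _ * _ - _ * _
    rw [mul_sub_mul_of_commute (hc _ _) (hc _ _), ← map_mul, ← map_mul, ← map_mul, ← map_mul,
      ← map_sub, ← map_sub, mul_sub_mul_of_commute (glTwo_commute_glTwo zero_ne_one _ _ _ _)
      (glTwo_commute_glTwo zero_ne_one _ _ _ _), glTwo_mul_sub, glTwo_mul_sub]

lemma sl2CubedEmbedding_apply (ν μ : A) (t : SL2 × SL2 × SL2) : sl2CubedEmbedding ν μ t =
    Matrix.scalar (Fin 2) (glTwo 0 ν t.1.1 + glTwo 1 μ t.2.1.1) +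
      (algebraMap ℂ (PolyOp A)).mapMatrix t.2.2.1 := rfl

lemma sl2CubedEmbedding_injective [Nontrivial A] (ν μ : A) :
    Function.Injective (sl2CubedEmbedding ν μ) := by
  refine (injective_iff_map_eq_zero (sl2CubedEmbedding ν μ)).2 ?_
  rintro ⟨a, b, c⟩ h
  have hentry : ∀ r s, sl2CubedEmbedding ν μ (a, b, c) r s = 0 := fun r s => congrFun₂ h r s
  have hinj : Function.Injective (algebraMap ℂ (PolyOp A)) := (algebraMap ℂ (PolyOp A)).injective
  have h00 := hentry 0 0
  have h01 := hentry 0 1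
  have h10 := hentry 1 0
  have h11 := hentry 1 1
  simp only [sl2CubedEmbedding_apply, Matrix.add_apply, Matrix.scalar_apply,
    RingHom.mapMatrix_apply, Matrix.map_apply, Matrix.diagonal_apply_eq, Matrix.diagonal_apply_ne _ zero_ne_one,
    Matrix.diagonal_apply_ne _ one_ne_zero, zero_add, map_eq_zero_iff _ hinj] at h00 h01 h10 h11
  -- The off-diagonal entries of c vanish, and comparing the two diagonal entries makes c scalar,
  -- hence zero by trace.
  have hc : c = 0 := sl2_eq_zero ⟨h01, h10, hinj (add_left_cancel (h11.trans h00.symm))⟩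
  subst hc
  rw [Algebra.algebraMap_eq_smul_one] at h00
  have ha : a = 0 := sl2_eq_zero (glTwo_eq_zero_aux zero_ne_one h00)
  have hb : b = 0 := sl2_eq_zero (glTwo_eq_zero_aux one_ne_zero
    (by rw [add_comm (glTwo 1 μ b.1)]; exact h00))
  rw [ha, hb]
  rfl

lemma sl2CubedEmbedding_fst (ν μ : A) (a : SL2) : sl2CubedEmbedding ν μ (a, 0, 0) =
    slDiag 0 ν a := by
  refine Matrix.ext fun r s => ?_
  change Matrix.scalar (Fin 2) (glTwo 0 ν a.1 + glTwo 1 μ 0) r s +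
    (algebraMap ℂ (PolyOp A)).mapMatrix 0 r s = opDiag (glTwo 0 ν a.1) (glTwo 0 ν a.1) r s
  fin_cases r <;> fin_cases s <;> simp [opDiag]

lemma sl2CubedEmbedding_snd (ν μ : A) (b : SL2) : sl2CubedEmbedding ν μ (0, b, 0) =
    slDiag 1 μ b := by
  refine Matrix.ext fun r s => ?_
  change Matrix.scalar (Fin 2) (glTwo 0 ν 0 + glTwo 1 μ b.1) r s +
    (algebraMap ℂ (PolyOp A)).mapMatrix 0 r s = opDiag (glTwo 1 μ b.1) (glTwo 1 μ b.1) r s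
  fin_cases r <;> fin_cases s <;> simp [opDiag]

lemma sl2CubedEmbedding_thd (ν μ : A) (c : SL2) : sl2CubedEmbedding ν μ (0, 0, c) =
    (algebraMap ℂ (PolyOp A)).mapMatrix c.1 := by
  change Matrix.scalar (Fin 2) (glTwo 0 ν 0 + glTwo 1 μ 0) + _ = _
  simp

lemma opDown_one_eq (ν μ : A) : opDown 1 = sl2CubedEmbedding ν μ (0, 0, -slPlus) := by
  rw [sl2CubedEmbedding_thd]
  change _ = (algebraMap ℂ (PolyOp A)).mapMatrix (-slPlus.1)
  refine Matrix.ext fun r s => ?_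
  fin_cases r <;> fin_cases s <;> simp [opDown, slPlus]

lemma opUp_one_eq (ν μ : A) : opUp 1 = sl2CubedEmbedding ν μ (0, 0, slMinus) := by
  rw [sl2CubedEmbedding_thd]
  refine Matrix.ext fun r s => ?_
  fin_cases r <;> fin_cases s <;> simp [opUp, slMinus]

lemma opDiag_one_neg_one_eq (ν μ : A) :
    opDiag 1 (-1) = sl2CubedEmbedding ν μ (0, 0, (-2 : ℂ) • slZero) := by
  rw [sl2CubedEmbedding_thd]
  change _ = (algebraMap ℂ (PolyOp A)).mapMatrix ((-2 : ℂ) • slZero.1)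
  refine Matrix.ext fun r s => ?_
  fin_cases r <;> fin_cases s <;> simp [opDiag, slZero]

/-- Each summand sl₂ is spanned by elements that map, up to nonzero factors, to generators, so both
inclusions need only be checked on generators. -/
lemma lieS00_eq_range (ν μ : A) : lieS00 ν μ = (sl2CubedEmbedding ν μ).range := by
  apply le_antisymm
  · refine LieSubalgebra.lieSpan_le.2 ?_
    rw [gensQ_zero_zero, gensST_zero_zero]
    rintro _ (((⟨a, -, rfl⟩ | ⟨a, -, rfl⟩) | rfl) | rfl | rfl)
    · exact ⟨_, sl2CubedEmbedding_fst ν μ a⟩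
    · exact ⟨_, sl2CubedEmbedding_snd ν μ a⟩
    · exact ⟨_, (opDiag_one_neg_one_eq ν μ).symm⟩
    · exact ⟨_, (opDown_one_eq ν μ).symm⟩
    · exact ⟨_, (opUp_one_eq ν μ).symm⟩
  · have hST : gensST 0 0 ν μ ⊆ lieS00 ν μ :=
      fun x hx => LieSubalgebra.subset_lieSpan (Or.inl (Or.inl hx))
    have hQ : gensQ 0 0 ν μ ⊆ lieS00 ν μ :=
      fun x hx => LieSubalgebra.subset_lieSpan (Or.inr hx)
    have hσ : opDiag 1 (-1) ∈ lieS00 ν μ := LieSubalgebra.subset_lieSpan (Or.inl (Or.inr rfl))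
    rw [gensST_zero_zero] at hST
    rw [gensQ_zero_zero] at hQ
    let N := (lieS00 ν μ).toSubmodule.comap (sl2CubedEmbedding ν μ).toLinearMap
    have key : ∀ f : SL2 →ₗ[ℂ] SL2 × SL2 × SL2, {slPlus, slMinus, slZero} ⊆ (N.comap f : Set SL2) →
        ∀ a, f a ∈ N := fun f hf a => by
      have := Submodule.span_le.2 hf
      rw [span_sl2] at this
      exact this Submodule.mem_top
    have h1 := key (LinearMap.inl ℂ SL2 (SL2 × SL2)) fun a ha => by
      change sl2CubedEmbedding ν μ (a, 0, 0) ∈ lieS00 ν μ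
      rw [sl2CubedEmbedding_fst]
      exact hST (Or.inl ⟨a, ha, rfl⟩)
    have h2 := key (LinearMap.inr ℂ SL2 (SL2 × SL2) ∘ₗ LinearMap.inl ℂ SL2 SL2) fun a ha => by
      change sl2CubedEmbedding ν μ (0, a, 0) ∈ lieS00 ν μ
      rw [sl2CubedEmbedding_snd]
      exact hST (Or.inr ⟨a, ha, rfl⟩)
    have h3 := key (LinearMap.inr ℂ SL2 (SL2 × SL2) ∘ₗ LinearMap.inr ℂ SL2 SL2) fun a ha => by
      let f := LinearMap.inr ℂ SL2 (SL2 × SL2) ∘ₗ LinearMap.inr ℂ SL2 SL2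
      rcases ha with rfl | rfl | rfl
      · refine (Submodule.neg_mem_iff (N.comap f)).1 ?_
        change sl2CubedEmbedding ν μ (0, 0, -slPlus) ∈ lieS00 ν μ
        rw [← opDown_one_eq]
        exact hQ (Or.inl rfl)
      · change sl2CubedEmbedding ν μ (0, 0, slMinus) ∈ lieS00 ν μ
        rw [← opUp_one_eq]
        exact hQ (Or.inr rfl)
      · refine ((N.comap f).smul_mem_iff (neg_ne_zero.2 (two_ne_zero (α := ℂ)))).1 ?_
        change sl2CubedEmbedding ν μ (0, 0, (-2 : ℂ) • slZero) ∈ lieS00 ν μ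
        rw [← opDiag_one_neg_one_eq]
        exact hσ
    rintro _ ⟨⟨a, b, c⟩, rfl⟩
    have h := N.add_mem (h1 a) (N.add_mem (h2 b) (h3 c))
    have he : LinearMap.inl ℂ SL2 (SL2 × SL2) a +
        (LinearMap.inr ℂ SL2 (SL2 × SL2) (LinearMap.inl ℂ SL2 SL2 b) +
        LinearMap.inr ℂ SL2 (SL2 × SL2) (LinearMap.inr ℂ SL2 SL2 c)) = (a, b, c) := by simp
    exact (he ▸ h :)

lemma nonempty_lieS00_equiv [Nontrivial A] (ν μ : A) :
    Nonempty (lieS00 ν μ ≃ₗ⁅ℂ⁆ SL2 × SL2 × SL2) := by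
  rw [lieS00_eq_range]
  exact ⟨(LieEquiv.ofInjective _ (sl2CubedEmbedding_injective ν μ)).symm⟩

end LieCase

/-! ### The dimension criterion -/

section Main

lemma finiteDimensional_superS_iff {A : Type} [CommRing A] [Algebra ℂ A] [Nontrivial A] (Δ Γ : ℕ)
    (ν μ : A) : FiniteDimensional ℂ (superS Δ Γ ν μ).carrier ↔ Δ + Γ ≤ 1 := by
  refine ⟨fun h => ?_, fun h => ?_⟩
  · by_contra hlt
    exact not_finiteDimensional_superS Δ Γ ν μ (by omega) h
  · obtain ⟨rfl, rfl⟩ | ⟨rfl, rfl⟩ | ⟨rfl, rfl⟩ :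
        (Δ = 0 ∧ Γ = 0) ∨ (Δ = 1 ∧ Γ = 0) ∨ (Δ = 0 ∧ Γ = 1) := by omega
    exacts [finiteDimensional_superS_zero_zero ν μ, finiteDimensional_superS_one_zero ν μ,
      finiteDimensional_superS_zero_one ν μ]

end Main

end

/-- The parts for `formalN`, `formalM` concern the abstract algebras, in which `n` and `m` are
formal; the parts for natural numbers `n`, `m` concern the concrete realizations. -/
theorem mainTheorem11 :
    (∀ Δ Γ : ℕ,
      (FiniteDimensional ℂ (superS Δ Γ formalN formalM).carrier ↔ Δ + Γ ≤ 1) ∧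
      ∀ n m : ℕ, Δ ≤ n → Γ ≤ m →
        (FiniteDimensional ℂ (superS Δ Γ (n : ℂ) (m : ℂ)).carrier ↔ Δ + Γ ≤ 1)) ∧
    (SuperIso (superS10 formalN formalM).carrier (spl21.carrier × SL2) ∧
      ∀ n m : ℕ, 1 ≤ n →
        SuperIso (superS10 (n : ℂ) (m : ℂ)).carrier (spl21.carrier × SL2)) ∧
    (SuperIso (superS01 formalN formalM).carrier (spl21.carrier × SL2) ∧
      ∀ n m : ℕ, 1 ≤ m →
        SuperIso (superS01 (n : ℂ) (m : ℂ)).carrier (spl21.carrier × SL2)) ∧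
    (Nonempty (lieS00 formalN formalM ≃ₗ⁅ℂ⁆ SL2 × SL2 × SL2) ∧
      ∀ n m : ℕ, Nonempty (lieS00 (n : ℂ) (m : ℂ) ≃ₗ⁅ℂ⁆ SL2 × SL2 × SL2)) := by
  exact ⟨fun Δ Γ => ⟨finiteDimensional_superS_iff Δ Γ _ _,
      fun n m _ _ => finiteDimensional_superS_iff Δ Γ _ _⟩,
    ⟨superIso_superS10 _ _, fun n m _ => superIso_superS10 _ _⟩,
    ⟨superIso_superS01 _ _, fun n m _ => superIso_superS01 _ _⟩,
    nonempty_lieS00_equiv _ _, fun n m => nonempty_lieS00_equiv _ _⟩
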